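/- Let $n,k\ge 0$ be integers and let $x_1,\dots,x_n\ge 0$ and $y_1,\dots,y_k\ge 0$ be real numbers. For a partition $\lambda=(\lambda_1\ge\lambda_2\ge\cdots)$ whose Young diagram is contained in the $n\times k$ rectangle (at most $n$ rows, $\lambda_1\le k$) let $$\mu_{n,k}(\lambda\mid x,y)=\frac{s_\lambda(x_1,\dots,x_n)\,s_{\lambda'}(y_1,\dots,y_k)}{\prod_{i=1}^n\prod_{j=1}^k(1+x_iy_j)},$$ where $\lambda'$ is the conjugate partition and $s_\lambda(x_1,\dots,x_n)=\sum_T\prod_{i=1}^n x_i^{T_i}$ is the Schur polynomial, the sum being over the semistandard Young tableaux $T$ of shape $\lambda$ with entries in $\{1,\dots,n\}$, and $T_i$ being the number of boxes of $T$ with entry $i$. Put $a_i=a_i(\lambda)=\lambda_i-i+\tfrac12\in\mathbb Z+\tfrac12$ for $i\ge1$, and $$K(z)=\prod_{i=1}^n\frac1{1-x_iz}\prod_{j=1}^k\frac1{1+y_j/z}.$$ Call a pair of closed piecewise $C^1$ contours $\gamma_z,\gamma_w$ in $\mathbb C$ admissible if $|w|<|z|$ for all $w\in\gamma_w$, $z\in\gamma_z$;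 $\gamma_w$ goes once, counterclockwise, around $0$; $\gamma_z$ goes once, counterclockwise, around $0$ and around every $-y_j$; and every $x_i^{-1}$ with $x_i\ne0$ lies outside $\gamma_z$ (that is: the respective points are off the contours, and the winding numbers about them are $1$, $1$ and $0$). Then admissible pairs exist, and for $m,m'\in\mathbb Z+\tfrac12$ the integral $$\mathcal K(m,m')=\oint_{\gamma_z}\frac{dz}{2\pi\mathrm i z}\oint_{\gamma_w}\frac{dw}{2\pi\mathrm i w}\,\frac{K(z)}{K(w)}\,z^{-m}w^{m'}\frac{\sqrt{zw}}{z-w}$$ (where $z^{-m}w^{m'}\sqrt{zw}$ means the single-valued function $z^{1/2-m}w^{m'+1/2}$) does not depend on the admissible pair. The measure $\mu_{n,k}(\,\cdot\mid x,y)$ is determinantal with correlation kernel $\mathcal K$: for every $\lambda$ in the $n\times k$ rectangle $$\mu_{n,k}(\lambda\mid x,y)=\det\bigl[\mathcal K(a_i,a_j)\bigr]_{i,j=1}^n,$$ and, for every $r\ge0$ and all distinct $s_1,\dots,s_r\in\mathbb Z+\tfrac12$, $$\sum_{\lambda:\ \{s_1,\dots,s_r\}\subseteq\{a_i(\lambda)\,:\,i\ge1\}}\mu_{n,k}(\lambda\mid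 x,y)=\det\bigl[\mathcal K(s_i,s_j)\bigr]_{i,j=1}^r,$$ where the sum is over the partitions $\lambda$ in the $n\times k$ rectangle. (For $r=0$ this says that $\mu_{n,k}$ has total mass $1$.) -/

import Mathlib

open scoped BigOperators

noncomputable section

namespace DualCauchy

/-! ### Schur polynomials and the dual Cauchy measure -/

/-- Semistandard Young tableaux of shape `lam` whose entries are among the `n` letters
`0, …, n - 1` (the letters are numbered from `0`, as the variables `x : Fin n → ℝ` are). -/
def BoundedSSYT (lam : YoungDiagram) (n : ℕ) : Type :=
  {T : SemistandardYoungTableau lam // ∀ c ∈ lam.cells, T c.1 c.2 < n}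

instance (lam : YoungDiagram) (n : ℕ) : Finite (BoundedSSYT lam n) := by
  let f : BoundedSSYT lam n → (lam.cells → Fin n) :=
    fun T c => ⟨T.1 c.1.1 c.1.2, T.2 c.1 c.2⟩
  refine Finite.of_injective f ?_
  intro T T' h
  apply Subtype.ext
  ext i j
  by_cases hc : (i, j) ∈ lam
  · have := congrFun h ⟨(i, j), (YoungDiagram.mem_cells _).2 hc⟩
    simpa [f] using this
  · rw [T.1.zeros hc, T'.1.zeros hc]

instance (lam : YoungDiagram) (n : ℕ) : Fintype (BoundedSSYT lam n) :=
  Fintype.ofFinite _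

/-- The number of boxes of `T` with the entry `i`. -/
def BoundedSSYT.weight {lam : YoungDiagram} {n : ℕ} (T : BoundedSSYT lam n) (i : Fin n) : ℕ :=
  (lam.cells.filter fun c => T.1 c.1 c.2 = (i : ℕ)).card

/-- The Schur polynomial `s_lam(x_1, …, x_n)`, as a sum over semistandard tableaux. -/
def schur {n : ℕ} (lam : YoungDiagram) (x : Fin n → ℝ) : ℝ :=
  ∑ T : BoundedSSYT lam n, ∏ i : Fin n, x i ^ T.weight i

/-- The Young diagrams with at most `n` rows and at most `k` columns. -/
def boxDiagrams (n k : ℕ) : Finset YoungDiagram :=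
  (Finset.range n ×ˢ Finset.range k).powerset.preimage YoungDiagram.cells
    (fun _ _ _ _ h => YoungDiagram.ext h)

/-- The weight of the diagram `lam ⊆ n × k` under the dual Cauchy measure. -/
def dualCauchyMeasure {n k : ℕ} (x : Fin n → ℝ) (y : Fin k → ℝ) (lam : YoungDiagram) : ℝ :=
  schur lam x * schur lam.transpose y / ∏ i : Fin n, ∏ j : Fin k, (1 + x i * y j)

/-! ### Maya coordinates and correlation functions -/

/-- The shifted lattice `ℤ + 1/2`. -/
def halfIntegers : Set ℝ := {m | ∃ a : ℤ, m = a + 1 / 2}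

/-- The Maya coordinate `lam_i - i + 1/2` of the `i`-th row; rows are counted from `0` here,
so that row `i` is the `(i + 1)`-st row in the usual numbering. -/
def mayaCoord (lam : YoungDiagram) (i : ℕ) : ℝ :=
  (lam.rowLen i : ℝ) - ((i : ℝ) + 1) + 1 / 2

/-- The Maya diagram of `lam`: the infinite set of all its Maya coordinates. -/
def mayaDiagram (lam : YoungDiagram) : Set ℝ := Set.range (mayaCoord lam)

open Classical in
/-- The correlation function of the point process of Maya diagrams: the probability, under the
dual Cauchy measure, that all the points `s_1, …, s_r` are occupied. -/
def correlation {n k : ℕ} (x : Fin n → ℝ) (y : Fin k → ℝ) {r : ℕ} (s : Fin r → ℝ) : ℝ :=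
  ∑ lam ∈ (boxDiagrams n k).filter (fun lam => ∀ i, s i ∈ mayaDiagram lam),
    dualCauchyMeasure x y lam

/-! ### Contours -/

/-- Closed piecewise continuously differentiable curves, parametrized by `[0, 1]`. -/
def IsContour (γ : ℝ → ℂ) : Prop :=
  γ 0 = γ 1 ∧ ∃ (N : ℕ) (t : ℕ → ℝ), Monotone t ∧ t 0 = 0 ∧ t N = 1 ∧
    ∀ i < N, ContDiffOn ℝ 1 γ (Set.Icc (t i) (t (i + 1)))

/-- The image of a contour. -/
def trace (γ : ℝ → ℂ) : Set ℂ := γ '' Set.Icc 0 1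

/-- The integral of `f` along `γ`. -/
def contourIntegral (γ : ℝ → ℂ) (f : ℂ → ℂ) : ℂ :=
  ∫ t in (0 : ℝ)..1, f (γ t) * deriv γ t

/-- The winding number of `γ` about a point `p` off `γ`. -/
def windingNumber (γ : ℝ → ℂ) (p : ℂ) : ℂ :=
  (2 * Real.pi * Complex.I)⁻¹ * contourIntegral γ (fun z => (z - p)⁻¹)

/-- `γ` goes once around `p`, in the positive direction. -/
def Encircles (γ : ℝ → ℂ) (p : ℂ) : Prop := p ∉ trace γ ∧ windingNumber γ p = 1

/-- `p` lies outside `γ`. -/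
def Excludes (γ : ℝ → ℂ) (p : ℂ) : Prop := p ∉ trace γ ∧ windingNumber γ p = 0

/-- The contours of the double integral: `|w| < |z|` on them, both go once around `0`, the
`z`-contour contains every `-y_j` and contains no `x_i⁻¹` (for `x_i = 0` there is no such point). -/
structure AdmissibleContours {n k : ℕ} (x : Fin n → ℝ) (y : Fin k → ℝ) (γz γw : ℝ → ℂ) :
    Prop where
  contour_z : IsContour γz
  contour_w : IsContour γw
  norm_lt : ∀ z ∈ trace γz, ∀ w ∈ trace γw, ‖w‖ < ‖z‖
  zero_z : Encircles γz 0
  zero_w : Encircles γw 0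
  contains_y : ∀ j, Encircles γz (-(y j : ℂ))
  excludes_x : ∀ i, x i ≠ 0 → Excludes γz ((x i : ℂ)⁻¹)

/-! ### The kernel -/

/-- `K(z) = ∏ 1 / (1 - x_i z) · ∏ 1 / (1 + y_j / z)`. -/
def symbolK {n k : ℕ} (x : Fin n → ℝ) (y : Fin k → ℝ) (z : ℂ) : ℂ :=
  (∏ i : Fin n, 1 / (1 - (x i : ℂ) * z)) * ∏ j : Fin k, 1 / (1 + (y j : ℂ) / z)

/-- The integrand `K(z)/K(w) · z^{-m} w^{m'} · √(zw) / (z - w)`. All the powers are taken with one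
and the same (principal) branch of the logarithm, and `√(zw) = z^{1/2} w^{1/2}`; for half-integers
`m, m'` the product is then the single-valued function `z^{1/2 - m} w^{m' + 1/2}`. -/
def kernelIntegrand {n k : ℕ} (x : Fin n → ℝ) (y : Fin k → ℝ) (m m' : ℝ) (z w : ℂ) : ℂ :=
  symbolK x y z / symbolK x y w * (z ^ (-(m : ℂ)) * w ^ (m' : ℂ)) *
    ((z ^ (1 / 2 : ℂ) * w ^ (1 / 2 : ℂ)) / (z - w))

/-- The double contour integral, with respect to `dz / (2πi z)` and `dw / (2πi w)`. -/
def kernelIntegral {n k : ℕ} (x : Fin n → ℝ) (y : Fin k → ℝ) (γz γw : ℝ → ℂ) (m m' : ℝ) : ℂ :=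
  contourIntegral γz fun z =>
    1 / (2 * Real.pi * Complex.I * z) *
      contourIntegral γw fun w =>
        1 / (2 * Real.pi * Complex.I * w) * kernelIntegrand x y m m' z w

end DualCauchy

end

/-!
The Jacobi–Trudi identities write `s_lam(x)` and `s_lam'(y)` as minors, one built from the complete
homogeneous polynomials of `x` and one from the elementary symmetric polynomials of `y`, both with
columns indexed by the Maya coordinates of `lam`. So the measure is a biorthogonal ensemble on the
`n`-point subsets of `n + k` consecutive sites, and by Cauchy–Binet its correlations are minors of
an explicit kernel as soon as the Gram matrix is inverted.

The inverse is expressed in the Laurent coefficients `u a = ∮ K(z) z^(-a-1) dz / 2πi`. Multiplying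
`K` by `∏ (1 - x_i z)` or by `∏ (1 + y_j / z)` turns into two linear recurrences for `u`. They yield
biorthogonality and evaluate the Toeplitz determinant of `u`, which normalizes the measure. They
also determine `u`, hence the independence of the contours: their characteristic polynomials are
coprime, because `1 + x_i y_j ≠ 0` when a contour separates `-y_j` from `x_i⁻¹`.
Expanding `1 / K(w)` and `1 / (z - w)` in powers of `w` identifies the double integral with the
kernel.
-/

noncomputable section

namespace DualCauchy

/-! ### Diagrams in a box and their coordinates -/

section Coordinates

variable {n k : ℕ} {lam mu : YoungDiagram}

theorem le_iff_rowLen_le : mu ≤ lam ↔ ∀ i, mu.rowLen i ≤ lam.rowLen i := by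
  refine ⟨fun h i => ?_, fun h ⟨i, j⟩ hij => ?_⟩
  · by_contra! hlt
    exact lt_irrefl _ (YoungDiagram.mem_iff_lt_rowLen.1 (h (YoungDiagram.mem_iff_lt_rowLen.2 hlt)))
  · exact YoungDiagram.mem_iff_lt_rowLen.2 ((YoungDiagram.mem_iff_lt_rowLen.1 hij).trans_le (h i))

theorem mem_boxDiagrams : lam ∈ boxDiagrams n k ↔ ∀ i j, (i, j) ∈ lam → i < n ∧ j < k := by
  have h : lam ∈ boxDiagrams n k ↔ lam.cells ∈ (Finset.range n ×ˢ Finset.range k).powerset :=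
    Finset.mem_preimage
  rw [h, Finset.mem_powerset, Finset.subset_iff]
  simp only [YoungDiagram.mem_cells, Finset.mem_product, Finset.mem_range, Prod.forall]

theorem mem_boxDiagrams_of_le (h : mu ≤ lam) (hl : lam ∈ boxDiagrams n k) :
    mu ∈ boxDiagrams n k :=
  mem_boxDiagrams.2 fun i j hm => mem_boxDiagrams.1 hl i j (h hm)

theorem transpose_mem_boxDiagrams : lam.transpose ∈ boxDiagrams k n ↔ lam ∈ boxDiagrams n k := by
  simp only [mem_boxDiagrams, YoungDiagram.mem_transpose, Prod.swap_prod_mk]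
  exact ⟨fun h i j hij => (h j i hij).symm, fun h i j hij => (h j i hij).symm⟩

theorem rowLen_le (h : lam ∈ boxDiagrams n k) (i : ℕ) : lam.rowLen i ≤ k := by
  by_contra! hk
  exact absurd (mem_boxDiagrams.1 h i k (YoungDiagram.mem_iff_lt_rowLen.2 hk)).2 (lt_irrefl _)

theorem rowLen_eq_zero (h : lam ∈ boxDiagrams n k) {i : ℕ} (hi : n ≤ i) : lam.rowLen i = 0 := by
  by_contra! hk
  have := (mem_boxDiagrams.1 h i 0 (YoungDiagram.mem_iff_lt_rowLen.2 (Nat.pos_of_ne_zero hk))).1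
  omega

/-- The integer `lam_i - i` (rows counted from `0`): the Maya coordinate plus `1 / 2`. -/
def coord (lam : YoungDiagram) (i : ℕ) : ℤ := (lam.rowLen i : ℤ) - i

theorem coord_strictAnti (lam : YoungDiagram) : StrictAnti (coord lam) := by
  intro i j hij
  have := lam.rowLen_anti i j hij.le
  simp only [coord]
  omega

theorem coord_mem_Icc (h : lam ∈ boxDiagrams n k) (i : Fin n) :
    coord lam i ∈ Finset.Icc (1 - (n : ℤ)) k := by
  have := rowLen_le h i
  have := i.2
  simp only [coord, Finset.mem_Icc]
  omega

theorem coord_eq_neg (h : lam ∈ boxDiagrams n k) {i : ℕ} (hi : n ≤ i) : coord lam i = -i := by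
  simp [coord, rowLen_eq_zero h hi]

theorem le_iff_coord_le (h : mu ∈ boxDiagrams n k) :
    mu ≤ lam ↔ ∀ i : Fin n, coord mu i ≤ coord lam i := by
  simp only [coord, sub_le_sub_iff_right, Nat.cast_le, le_iff_rowLen_le]
  refine ⟨fun hle i => hle i, fun hle i => ?_⟩
  rcases lt_or_ge i n with hi | hi
  · exact hle ⟨i, hi⟩
  · exact (rowLen_eq_zero h hi).trans_le (Nat.zero_le _)

theorem eq_of_coord_eq (h : lam ∈ boxDiagrams n k) (h' : mu ∈ boxDiagrams n k)
    (he : ∀ i : Fin n, coord lam i = coord mu i) : lam = mu :=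
  le_antisymm ((le_iff_coord_le h).2 fun i => (he i).le)
    ((le_iff_coord_le h').2 fun i => (he i).ge)

theorem add_antitone_of_strictAnti {c : Fin n → ℤ} (hc : StrictAnti c) :
    Antitone fun i : Fin n => c i + i := by
  obtain _ | n := n
  · exact fun i => i.elim0
  · refine Fin.antitone_iff_succ_le.2 fun i => ?_
    have := hc i.castSucc_lt_succ
    simp only [Fin.val_succ, Fin.val_castSucc]
    push_cast
    omega

theorem exists_diagram_of_strictAnti {c : Fin n → ℤ} (hc : StrictAnti c)
    (hS : ∀ i, c i ∈ Finset.Icc (1 - (n : ℤ)) k) :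
    ∃ lam ∈ boxDiagrams n k, ∀ i : Fin n, coord lam i = c i := by
  have hanti := add_antitone_of_strictAnti hc
  have hbound (i : Fin n) : 0 ≤ c i + i ∧ c i + i ≤ k := by
    obtain ⟨n, rfl⟩ : ∃ m, n = m + 1 := ⟨n - 1, by have := i.2; omega⟩
    have hlast := hanti (Fin.le_last i)
    have hzero := hanti (Fin.zero_le i)
    have h0 := (Finset.mem_Icc.1 (hS 0)).2
    have hn := (Finset.mem_Icc.1 (hS (Fin.last n))).1
    simp only [Fin.val_last, Fin.val_zero] at hlast hzero
    push_cast at hn hzero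
    omega
  let w : List ℕ := List.ofFn fun i : Fin n => (c i + i).toNat
  have hw : w.SortedGE :=
    Antitone.sortedGE_ofFn fun i j hij => Int.toNat_le_toNat (hanti hij)
  refine ⟨YoungDiagram.ofRowLens w hw, mem_boxDiagrams.2 fun i j hij => ?_, fun i => ?_⟩
  · obtain ⟨hi, hj⟩ := YoungDiagram.mem_ofRowLens.1 hij
    have hi' : i < n := by simpa [w] using hi
    have := (hbound ⟨i, hi'⟩).2
    simp only [w, List.getElem_ofFn] at hj this
    exact ⟨hi', by omega⟩
  · have hrow := YoungDiagram.rowLen_ofRowLens (w := w) (hw := hw) ⟨i, by simp [w]⟩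
    simp only [w, Fin.getElem_fin, List.getElem_ofFn] at hrow
    have := (hbound i).1
    rw [coord, hrow]
    simp only [Fin.eta]
    omega

theorem card_eq_sum_rowLen (hl : lam ∈ boxDiagrams n k) :
    lam.card = ∑ i : Fin n, lam.rowLen i := by
  rw [YoungDiagram.card, Finset.card_eq_sum_card_fiberwise (f := Prod.fst)
    (t := Finset.range n) (fun c hc => Finset.mem_coe.2 (Finset.mem_range.2
      (mem_boxDiagrams.1 hl c.1 c.2 hc).1)), Finset.sum_range]
  refine Finset.sum_congr rfl fun i _ => ?_
  rw [YoungDiagram.rowLen_eq_card]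
  rfl

theorem sum_toNat_coord_sub (hl : lam ∈ boxDiagrams n k) (hm : mu ∈ boxDiagrams n k)
    (hle : ∀ i : Fin n, coord mu i ≤ coord lam i) :
    ∑ i : Fin n, (coord lam i - coord mu i).toNat = lam.card - mu.card := by
  rw [card_eq_sum_rowLen hl, card_eq_sum_rowLen hm, ← Finset.sum_tsub_distrib]
  · refine Finset.sum_congr rfl fun i _ => ?_
    simp only [coord]
    omega
  · intro i _
    have := hle i
    simp only [coord] at this
    omega

end Coordinates

/-! ### The Cauchy–Binet formula over the diagrams in a box -/

section CauchyBinet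

variable {R : Type*} [CommRing R]

theorem det_sum_mul_eq_sum_pi {ι α : Type*} [Fintype ι] [DecidableEq ι] (S : Finset α)
    (f g : ι → α → R) :
    Matrix.det (Matrix.of fun i j => ∑ a ∈ S, f i a * g j a) =
      ∑ φ ∈ Fintype.piFinset fun _ : ι => S,
        (∏ i, f i (φ i)) * Matrix.det (Matrix.of fun i j => g j (φ i)) := by
  classical
  have hrows : (Matrix.of fun i j => ∑ a ∈ S, f i a * g j a) =
      fun i => ∑ a ∈ S, f i a • (fun j => g j a : ι → R) := by
    ext i j
    simp [Finset.sum_apply]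
  rw [hrows]
  refine ((Matrix.detRowAlternating (n := ι) (R := R)).toMultilinearMap.map_sum_finset
    (fun i a => f i a • (fun j => g j a : ι → R)) fun _ => S).trans ?_
  exact Finset.sum_congr rfl fun φ _ =>
    (Matrix.detRowAlternating (n := ι) (R := R)).toMultilinearMap.map_smul_univ _ _

theorem det_eq_zero_of_not_injective {ι α : Type*} [Fintype ι] [DecidableEq ι]
    (g : ι → α → R) {φ : ι → α} (hφ : ¬ Function.Injective φ) :
    Matrix.det (Matrix.of fun i j => g j (φ i)) = 0 := by
  simp only [Function.Injective, not_forall] at hφ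
  obtain ⟨a, b, hab, hne⟩ := hφ
  exact Matrix.det_zero_of_row_eq hne (by ext j; simp [hab])

theorem det_mul_det_eq_sum_perm {ι : Type*} [Fintype ι] [DecidableEq ι] (A B : Matrix ι ι R) :
    A.det * B.det =
      ∑ σ : Equiv.Perm ι, (∏ i, A i (σ i)) * Matrix.det (Matrix.of fun i j => B j (σ i)) := by
  rw [← Matrix.det_transpose, Matrix.det_apply', Finset.sum_mul]
  refine Finset.sum_congr rfl fun σ _ => ?_
  have hperm : (Matrix.of fun i j => B j (σ i)) = B.transpose.submatrix σ id := rfl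
  rw [hperm, Matrix.det_permute, Matrix.det_transpose]
  simp only [Matrix.transpose_apply]
  ring

theorem eq_and_eq_of_coord_perm_eq {N k : ℕ} {lam mu : YoungDiagram}
    (hl : lam ∈ boxDiagrams N k) (hm : mu ∈ boxDiagrams N k) {σ τ : Equiv.Perm (Fin N)}
    (h : ∀ i, coord lam (σ i) = coord mu (τ i)) : lam = mu ∧ σ = τ := by
  have hmono (nu : YoungDiagram) : StrictMono fun i : Fin N => OrderDual.toDual (coord nu i) :=
    fun _ _ hij => coord_strictAnti nu hij
  have hrange : Set.range (fun i : Fin N => OrderDual.toDual (coord lam i)) =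
      Set.range fun i : Fin N => OrderDual.toDual (coord mu i) := by
    ext a
    constructor
    · rintro ⟨i, rfl⟩
      exact ⟨τ (σ.symm i), by simp [← h]⟩
    · rintro ⟨i, rfl⟩
      exact ⟨σ (τ.symm i), by simp [h]⟩
  obtain rfl : lam = mu := eq_of_coord_eq hl hm
    fun i => congrFun ((StrictMono.range_inj (hmono lam) (hmono mu)).1 hrange) i
  exact ⟨rfl, Equiv.ext fun i => Fin.ext ((coord_strictAnti lam).injective (h i))⟩

theorem exists_coord_perm_eq {N k : ℕ} {φ : Fin N → ℤ} (hinj : Function.Injective φ)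
    (hS : ∀ i, φ i ∈ Finset.Icc (1 - (N : ℤ)) k) :
    ∃ lam ∈ boxDiagrams N k, ∃ σ : Equiv.Perm (Fin N), ∀ i, coord lam (σ i) = φ i := by
  let σ := Tuple.sort (OrderDual.toDual ∘ φ)
  have hm : Monotone ((OrderDual.toDual ∘ φ) ∘ σ) := Tuple.monotone_sort _
  have ha : StrictAnti (φ ∘ σ) := fun i j hij =>
    lt_of_le_of_ne (hm hij.le) fun h => hij.ne' (σ.injective (hinj h))
  obtain ⟨lam, hl, hc⟩ := exists_diagram_of_strictAnti (k := k) ha fun i => hS _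
  exact ⟨lam, hl, σ.symm, fun i => by simp [hc]⟩

open Classical in
theorem sum_injective_eq_sum_boxDiagrams (N k : ℕ) (F : (Fin N → ℤ) → R) :
    ∑ φ ∈ Fintype.piFinset (fun _ : Fin N => Finset.Icc (1 - (N : ℤ)) k) with
        Function.Injective φ, F φ =
      ∑ lam ∈ boxDiagrams N k, ∑ σ : Equiv.Perm (Fin N), F fun i => coord lam (σ i) := by
  rw [← Finset.sum_product']
  symm
  refine Finset.sum_bij (fun p _ => fun i => coord p.1 (p.2 i)) ?_ ?_ ?_ fun _ _ => rfl
  · rintro ⟨lam, σ⟩ h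
    have hl := (Finset.mem_product.1 h).1
    simp only [Finset.mem_filter, Fintype.mem_piFinset]
    exact ⟨fun i => coord_mem_Icc hl _,
      fun a b hab => σ.injective (Fin.ext ((coord_strictAnti lam).injective hab))⟩
  · rintro ⟨lam, σ⟩ h ⟨mu, τ⟩ h' he
    exact Prod.ext_iff.2 (eq_and_eq_of_coord_perm_eq (Finset.mem_product.1 h).1
      (Finset.mem_product.1 h').1 fun i => congrFun he i)
  · intro φ hφ
    simp only [Finset.mem_filter, Fintype.mem_piFinset] at hφ
    obtain ⟨lam, hl, σ, hσ⟩ := exists_coord_perm_eq hφ.2 hφ.1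
    exact ⟨(lam, σ), Finset.mem_product.2 ⟨hl, Finset.mem_univ _⟩, funext hσ⟩

theorem det_sum_mul_eq_sum_boxDiagrams (N k : ℕ) (f g : Fin N → ℤ → R) :
    Matrix.det (Matrix.of fun i j : Fin N => ∑ a ∈ Finset.Icc (1 - (N : ℤ)) k, f i a * g j a) =
      ∑ lam ∈ boxDiagrams N k,
        Matrix.det (Matrix.of fun i j : Fin N => f i (coord lam j)) *
          Matrix.det (Matrix.of fun i j : Fin N => g i (coord lam j)) := by
  classical
  rw [det_sum_mul_eq_sum_pi, ← Finset.sum_filter_of_ne (p := Function.Injective),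
    sum_injective_eq_sum_boxDiagrams]
  · simp only [det_mul_det_eq_sum_perm, Matrix.of_apply]
  · intro φ _ hne
    by_contra hni
    exact hne (by rw [det_eq_zero_of_not_injective g hni, mul_zero])

end CauchyBinet

/-! ### The branching rule for Schur polynomials -/

/-- `lam / mu` is a horizontal strip: it has at most one box in every column. -/
def IsHorizontalStrip (mu lam : YoungDiagram) : Prop :=
  mu ≤ lam ∧ ∀ i j, (i + 1, j) ∈ lam → (i, j) ∈ mu

theorem isHorizontalStrip_iff_rowLen {mu lam : YoungDiagram} :
    IsHorizontalStrip mu lam ↔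
      ∀ i, mu.rowLen i ≤ lam.rowLen i ∧ lam.rowLen (i + 1) ≤ mu.rowLen i := by
  simp only [IsHorizontalStrip, le_iff_rowLen_le, YoungDiagram.mem_iff_lt_rowLen, forall_and]
  exact and_congr_right fun _ => forall_congr' fun i => forall_lt_iff_le

theorem isHorizontalStrip_transpose_iff_rowLen {mu lam : YoungDiagram} :
    IsHorizontalStrip mu.transpose lam.transpose ↔
      ∀ i, mu.rowLen i ≤ lam.rowLen i ∧ lam.rowLen i ≤ mu.rowLen i + 1 := by
  have htr (nu : YoungDiagram) (i j : ℕ) : (i, j) ∈ nu.transpose ↔ i < nu.rowLen j :=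
    YoungDiagram.mem_transpose.trans YoungDiagram.mem_iff_lt_rowLen
  rw [IsHorizontalStrip, YoungDiagram.transpose_le_iff, le_iff_rowLen_le, forall_and]
  simp only [htr]
  refine and_congr_right fun _ => ⟨fun h i => ?_, fun h j i hj => ?_⟩
  · by_contra! hlt
    exact lt_irrefl _ (h _ i hlt)
  · have := h i
    omega

section Coordinates

variable {n k : ℕ} {lam mu : YoungDiagram}

theorem isHorizontalStrip_iff_coord (hl : lam ∈ boxDiagrams n k) (hm : mu ∈ boxDiagrams n k) :
    IsHorizontalStrip mu lam ↔ (∀ i : Fin n, coord mu i ≤ coord lam i) ∧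
      ∀ i i' : Fin n, i < i' → coord lam i' < coord mu i := by
  rw [isHorizontalStrip_iff_rowLen, forall_and, ← le_iff_rowLen_le, le_iff_coord_le hm]
  refine and_congr_right fun _ => ⟨fun h i i' hi => ?_, fun h i => ?_⟩
  · have := h i
    have := lam.rowLen_anti (i + 1) i' hi
    have : (i : ℕ) < i' := hi
    simp only [coord]
    omega
  · rcases lt_or_ge (i + 1) n with hi | hi
    · have := h ⟨i, by omega⟩ ⟨i + 1, hi⟩ (by simp [Fin.lt_def])
      simp only [coord] at this
      push_cast at this
      omega
    · exact (rowLen_eq_zero hl hi).trans_le (Nat.zero_le _)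

theorem isHorizontalStrip_transpose_iff_coord (hl : lam ∈ boxDiagrams n k)
    (hm : mu ∈ boxDiagrams n k) :
    IsHorizontalStrip mu.transpose lam.transpose ↔
      ∀ i : Fin n, coord mu i ≤ coord lam i ∧ coord lam i ≤ coord mu i + 1 := by
  rw [isHorizontalStrip_transpose_iff_rowLen]
  refine ⟨fun h i => ?_, fun h i => ?_⟩
  · have := h i
    simp only [coord]
    omega
  · rcases lt_or_ge i n with hi | hi
    · have := h ⟨i, hi⟩
      simp only [coord] at this
      omega
    · simp [rowLen_eq_zero hl hi, rowLen_eq_zero hm hi]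

end Coordinates

namespace BoundedSSYT

variable {lam mu : YoungDiagram} {n m : ℕ}

/-- The entry of a tableau in the box `(i, j)`; it is `0` outside the shape. -/
def entry (T : BoundedSSYT lam n) (i j : ℕ) : ℕ := T.1 i j

theorem weight_eq_card (T : BoundedSSYT lam n) (i : Fin n) :
    T.weight i = (lam.cells.filter fun c => T.entry c.1 c.2 = (i : ℕ)).card := rfl

theorem entry_lt (T : BoundedSSYT lam n) {i j : ℕ} (h : (i, j) ∈ lam) : T.entry i j < n :=
  T.2 (i, j) ((YoungDiagram.mem_cells _).2 h)

theorem entry_eq_zero (T : BoundedSSYT lam n) {i j : ℕ} (h : (i, j) ∉ lam) : T.entry i j = 0 :=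
  T.1.zeros h

theorem entry_lt_entry (T : BoundedSSYT lam n) {i i' j : ℕ} (hi : i < i') (h : (i', j) ∈ lam) :
    T.entry i j < T.entry i' j :=
  T.1.col_strict hi h

theorem entry_le_entry (T : BoundedSSYT lam n) {i j j' : ℕ} (hj : j < j') (h : (i, j') ∈ lam) :
    T.entry i j ≤ T.entry i j' :=
  T.1.row_weak hj h

theorem ext_entry {T T' : BoundedSSYT lam n}
    (h : ∀ i j, (i, j) ∈ lam → T.entry i j = T'.entry i j) : T = T' := by
  refine Subtype.ext (SemistandardYoungTableau.ext fun i j => ?_)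
  by_cases hij : (i, j) ∈ lam
  · exact h i j hij
  · exact (T.entry_eq_zero hij).trans (T'.entry_eq_zero hij).symm

/-- The shape formed by the boxes of a tableau with entries less than `m`. -/
def shapeBelow (T : BoundedSSYT lam n) (m : ℕ) : YoungDiagram where
  cells := lam.cells.filter fun c => T.entry c.1 c.2 < m
  isLowerSet := by
    rintro ⟨i, j⟩ ⟨i', j'⟩ ⟨hi, hj⟩ hmem
    simp only [Finset.coe_filter, YoungDiagram.mem_cells, Set.mem_ofPred_eq] at hmem ⊢
    refine ⟨lam.up_left_mem hi hj hmem.1, lt_of_le_of_lt ?_ hmem.2⟩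
    exact (T.1.col_weak hi (lam.up_left_mem le_rfl hj hmem.1)).trans
      (T.1.row_weak_of_le hj hmem.1)

theorem mem_shapeBelow {T : BoundedSSYT lam n} {i j : ℕ} :
    (i, j) ∈ T.shapeBelow m ↔ (i, j) ∈ lam ∧ T.entry i j < m := by
  rw [← YoungDiagram.mem_cells]
  simp [shapeBelow]

theorem isHorizontalStrip_shapeBelow (T : BoundedSSYT lam (m + 1)) :
    IsHorizontalStrip (T.shapeBelow m) lam := by
  refine ⟨fun ⟨i, j⟩ h => (mem_shapeBelow.1 h).1, fun i j h => ?_⟩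
  have h1 := T.entry_lt_entry (Nat.lt_add_one i) h
  have h2 := T.entry_lt h
  exact mem_shapeBelow.2 ⟨lam.up_left_mem (Nat.le_succ i) le_rfl h, by omega⟩

/-- The tableau formed by the boxes of `T` with entries less than `m`. -/
def restrict (T : BoundedSSYT lam n) (m : ℕ) : BoundedSSYT (T.shapeBelow m) m :=
  ⟨{ entry := fun i j => if (i, j) ∈ T.shapeBelow m then T.entry i j else 0
     row_weak' := by
      intro i j1 j2 hj h2
      have h1 := (T.shapeBelow m).up_left_mem le_rfl hj.le h2
      simp only [h1, h2, if_true]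
      exact T.entry_le_entry hj (mem_shapeBelow.1 h2).1
     col_strict' := by
      intro i1 i2 j hi h2
      have h1 := (T.shapeBelow m).up_left_mem hi.le le_rfl h2
      simp only [h1, h2, if_true]
      exact T.entry_lt_entry hi (mem_shapeBelow.1 h2).1
     zeros' := fun hn => if_neg hn }, by
    rintro ⟨i, j⟩ hc
    have hc' : (i, j) ∈ T.shapeBelow m := (YoungDiagram.mem_cells _).1 hc
    change (if (i, j) ∈ T.shapeBelow m then T.entry i j else 0) < m
    rw [if_pos hc']
    exact (mem_shapeBelow.1 hc').2⟩

theorem entry_restrict (T : BoundedSSYT lam n) (m i j : ℕ) :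
    (T.restrict m).entry i j = if (i, j) ∈ T.shapeBelow m then T.entry i j else 0 := rfl

/-- Fill the boxes of the horizontal strip `lam / mu` with the letter `m`. -/
def extend (h : IsHorizontalStrip mu lam) (T : BoundedSSYT mu m) : BoundedSSYT lam (m + 1) :=
  ⟨{ entry := fun i j => if (i, j) ∈ mu then T.1 i j else if (i, j) ∈ lam then m else 0
     row_weak' := by
      intro i j1 j2 hj hl
      have hl1 := lam.up_left_mem le_rfl hj.le hl
      by_cases h2 : (i, j2) ∈ mu
      · have h1 := mu.up_left_mem le_rfl hj.le h2
        simp only [h1, h2, if_true]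
        exact T.entry_le_entry hj h2
      · simp only [h2, if_false, hl, if_true, hl1]
        split_ifs with h1
        · exact (T.entry_lt h1).le
        · exact le_rfl
     col_strict' := by
      intro i1 i2 j hi hl
      have h1 : (i1, j) ∈ mu := h.2 i1 j (lam.up_left_mem hi le_rfl hl)
      simp only [h1, if_true, hl]
      split_ifs with h2
      · exact T.entry_lt_entry hi h2
      · exact T.entry_lt h1
     zeros' := by
      intro i j hl
      have h1 : (i, j) ∉ mu := fun hm => hl (h.1 hm)
      simp [h1, hl] }, by
    rintro ⟨i, j⟩ -
    change (if (i, j) ∈ mu then T.entry i j else if (i, j) ∈ lam then m else 0) < m + 1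
    split_ifs with h1 h2
    · exact (T.entry_lt h1).trans (Nat.lt_succ_self m)
    · exact Nat.lt_succ_self m
    · exact Nat.succ_pos m⟩

theorem entry_extend (h : IsHorizontalStrip mu lam) (T : BoundedSSYT mu m) (i j : ℕ) :
    (T.extend h).entry i j =
      if (i, j) ∈ mu then T.entry i j else if (i, j) ∈ lam then m else 0 := rfl

theorem shapeBelow_extend (h : IsHorizontalStrip mu lam) (T : BoundedSSYT mu m) :
    (T.extend h).shapeBelow m = mu := by
  apply YoungDiagram.ext
  ext ⟨i, j⟩
  rw [YoungDiagram.mem_cells, YoungDiagram.mem_cells, mem_shapeBelow, entry_extend]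
  constructor
  · rintro ⟨hl, hlt⟩
    by_contra hm
    simp [hm, hl] at hlt
  · intro hm
    exact ⟨h.1 hm, by simpa only [hm, if_true] using T.entry_lt hm⟩

theorem extend_injective (h : IsHorizontalStrip mu lam) :
    Function.Injective (extend h : BoundedSSYT mu m → BoundedSSYT lam (m + 1)) := by
  intro T T' he
  refine ext_entry fun i j hij => ?_
  have := congrArg (fun U : BoundedSSYT lam (m + 1) => U.entry i j) he
  simpa only [entry_extend, hij, if_true] using this

theorem extend_restrict (T : BoundedSSYT lam (m + 1)) :
    (T.restrict m).extend T.isHorizontalStrip_shapeBelow = T := by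
  refine ext_entry fun i j hij => ?_
  rw [entry_extend, entry_restrict]
  split_ifs with h
  · rfl
  · have hle : ¬ T.entry i j < m := fun hlt => h (mem_shapeBelow.2 ⟨hij, hlt⟩)
    have := T.entry_lt hij
    omega

theorem weight_extend_castSucc (h : IsHorizontalStrip mu lam) (T : BoundedSSYT mu m)
    (i : Fin m) : (T.extend h).weight i.castSucc = T.weight i := by
  rw [weight_eq_card, weight_eq_card]
  congr 1
  ext ⟨a, b⟩
  have hi := i.2
  rw [Finset.mem_filter, Finset.mem_filter]
  simp only [YoungDiagram.mem_cells, entry_extend, Fin.val_castSucc]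
  by_cases hm : (a, b) ∈ mu
  · simp [hm, h.1 hm]
  · simp only [hm, if_false, false_and, iff_false, not_and]
    intro hl
    simp only [hl, if_true]
    omega

theorem weight_extend_last (h : IsHorizontalStrip mu lam) (T : BoundedSSYT mu m) :
    (T.extend h).weight (Fin.last m) = lam.card - mu.card := by
  rw [weight_eq_card]
  unfold YoungDiagram.card
  rw [← Finset.card_sdiff_of_subset (YoungDiagram.cells_subset_iff.2 h.1)]
  congr 1
  ext ⟨a, b⟩
  rw [Finset.mem_filter, Finset.mem_sdiff]
  simp only [YoungDiagram.mem_cells, entry_extend, Fin.val_last]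
  by_cases hm : (a, b) ∈ mu
  · have := T.entry_lt hm
    simp only [hm, if_true, not_true, and_false, iff_false, not_and]
    omega
  · simp only [hm, if_false, not_false_eq_true, and_true, and_iff_left_iff_imp]
    intro hl
    simp [hl]

end BoundedSSYT

open Classical in
theorem schur_succ {m n k : ℕ} {lam : YoungDiagram} (hl : lam ∈ boxDiagrams n k)
    (x : Fin (m + 1) → ℝ) : schur lam x =
      ∑ mu ∈ boxDiagrams n k with IsHorizontalStrip mu lam,
        x (Fin.last m) ^ (lam.card - mu.card) * schur mu (fun i => x i.castSucc) := by
  have hmaps (T : BoundedSSYT lam (m + 1)) :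
      T.shapeBelow m ∈ {mu ∈ boxDiagrams n k | IsHorizontalStrip mu lam} :=
    Finset.mem_filter.2 ⟨mem_boxDiagrams_of_le T.isHorizontalStrip_shapeBelow.1 hl,
      T.isHorizontalStrip_shapeBelow⟩
  rw [schur, ← Finset.sum_fiberwise_of_maps_to fun T _ => hmaps T]
  refine Finset.sum_congr rfl fun mu hmu => ?_
  have h := (Finset.mem_filter.1 hmu).2
  rw [schur, Finset.mul_sum]
  symm
  refine Finset.sum_bij (fun T _ => T.extend h) ?_ ?_ ?_ ?_
  · intro T _
    simp [BoundedSSYT.shapeBelow_extend]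
  · exact fun T _ T' _ he => BoundedSSYT.extend_injective h he
  · intro T hT
    obtain rfl := (Finset.mem_filter.1 hT).2
    exact ⟨T.restrict m, Finset.mem_univ _, T.extend_restrict⟩
  · intro T _
    rw [Fin.prod_univ_castSucc, BoundedSSYT.weight_extend_last]
    simp only [BoundedSSYT.weight_extend_castSucc]
    ring

theorem exists_mem_of_ne_bot {lam : YoungDiagram} (h : lam ≠ ⊥) : ∃ c, c ∈ lam.cells :=
  Finset.nonempty_iff_ne_empty.2 fun he => h (YoungDiagram.ext (by simpa using he))

theorem schur_fin_zero (lam : YoungDiagram) (x : Fin 0 → ℝ) [Decidable (lam = ⊥)] :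
    schur lam x = if lam = ⊥ then 1 else 0 := by
  unfold schur
  split_ifs with h
  · subst h
    have : Unique (BoundedSSYT ⊥ 0) :=
      { default := ⟨default, by simp⟩
        uniq := fun T => BoundedSSYT.ext_entry fun i j hij =>
          absurd hij (YoungDiagram.notMem_bot _) }
    simp
  · obtain ⟨c, hc⟩ := exists_mem_of_ne_bot h
    have : IsEmpty (BoundedSSYT lam 0) := ⟨fun T => absurd (T.2 c hc) (Nat.not_lt_zero _)⟩
    simp

/-! ### Complete homogeneous and elementary symmetric polynomials -/

section Symm

variable {R : Type*} [CommRing R]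

/-- The complete homogeneous symmetric polynomial `h_r(x_1, …, x_m)`, for `r ∈ ℤ`, by recursion on
the number of variables. -/
def hsymm : {m : ℕ} → (Fin m → R) → ℤ → R
  | 0, _, r => (Pi.single 0 1 : ℤ → R) r
  | m + 1, x, r => ∑ b ∈ Finset.Icc 0 r,
      x (Fin.last m) ^ (r - b).toNat * hsymm (fun i => x i.castSucc) b

/-- The elementary symmetric polynomial `e_r(y_1, …, y_m)`, for `r ∈ ℤ`, by recursion on the number
of variables. -/
def esymm : {m : ℕ} → (Fin m → R) → ℤ → R
  | 0, _, r => (Pi.single 0 1 : ℤ → R) r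
  | m + 1, y, r => esymm (fun i => y i.castSucc) r +
      y (Fin.last m) * esymm (fun i => y i.castSucc) (r - 1)

variable {m : ℕ}

theorem hsymm_of_neg (x : Fin m → R) {r : ℤ} (hr : r < 0) : hsymm x r = 0 := by
  cases m with
  | zero => exact Pi.single_eq_of_ne hr.ne _
  | succ m => rw [hsymm, Finset.Icc_eq_empty (by lia), Finset.sum_empty]

theorem hsymm_zero (x : Fin m → R) : hsymm x 0 = 1 := by
  induction m with
  | zero => exact Pi.single_eq_same 0 1
  | succ m ih => simp [hsymm, ih]

theorem hsymm_succ_eq_sum (x : Fin (m + 1) → R) {L r : ℤ} (hr : L + r ≤ 0) (a : ℤ) :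
    hsymm x (a + r) = ∑ b ∈ Finset.Icc L a,
      x (Fin.last m) ^ (a - b).toNat * hsymm (fun i => x i.castSucc) (b + r) := by
  have hsub : Finset.Icc 0 (a + r) ⊆ Finset.Icc (L + r) (a + r) := Finset.Icc_subset_Icc_left hr
  rw [hsymm, Finset.sum_subset hsub fun b _ hb => ?_]
  · rw [← Finset.map_add_right_Icc, Finset.sum_map]
    simp [add_sub_add_right_eq_sub]
  · rw [hsymm_of_neg _ (by simp_all), mul_zero]

theorem hsymm_succ (x : Fin (m + 1) → R) (r : ℤ) :
    hsymm x r = hsymm (fun i => x i.castSucc) r + x (Fin.last m) * hsymm x (r - 1) := by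
  rcases lt_or_ge r 0 with h | h
  · simp [hsymm_of_neg _ h, hsymm_of_neg x (show r - 1 < 0 by lia)]
  have hI : Finset.Icc 0 r = insert r (Finset.Icc 0 (r - 1)) := by grind
  rw [hsymm, hI, Finset.sum_insert (by simp), sub_self, Int.toNat_zero,
    pow_zero, one_mul]
  rw [hsymm, Finset.mul_sum]
  congr 1
  refine Finset.sum_congr rfl fun b hb => ?_
  rw [← mul_assoc, ← pow_succ', show (r - 1 - b).toNat + 1 = (r - b).toNat by grind]

theorem esymm_of_neg (y : Fin m → R) {r : ℤ} (hr : r < 0) : esymm y r = 0 := by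
  induction m generalizing r with
  | zero => exact Pi.single_eq_of_ne hr.ne _
  | succ m ih => rw [esymm, ih _ hr, ih _ (by lia), mul_zero, add_zero]

theorem esymm_of_gt (y : Fin m → R) {r : ℤ} (hr : m < r) : esymm y r = 0 := by
  induction m generalizing r with
  | zero => exact Pi.single_eq_of_ne (by lia) _
  | succ m ih => rw [esymm, ih _ (by lia), ih _ (by lia), mul_zero, add_zero]

theorem esymm_zero (y : Fin m → R) : esymm y 0 = 1 := by
  induction m with
  | zero => exact Pi.single_eq_same 0 1
  | succ m ih => simp [esymm, ih, esymm_of_neg]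

theorem prod_one_add_smul {A : Type*} [CommRing A] [Algebra R A] (y : Fin m → R) (s : A) :
    ∏ j, (1 + y j • s) = ∑ p ∈ Finset.range (m + 1), esymm y p • s ^ p := by
  induction m with
  | zero => simp [esymm]
  | succ m ih =>
    have hlast : esymm (fun j => y j.castSucc) ((m + 1 : ℕ) : ℤ) = 0 :=
      esymm_of_gt _ (by push_cast; lia)
    have hshift : ∑ p ∈ Finset.range (m + 2),
        (y (Fin.last m) * esymm (fun j => y j.castSucc) ((p : ℤ) - 1)) • s ^ p =
        (∑ p ∈ Finset.range (m + 1), esymm (fun j => y j.castSucc) p • s ^ p) *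
          y (Fin.last m) • s := by
      rw [Finset.sum_range_succ', Nat.cast_zero, esymm_of_neg _ (by lia), Finset.sum_mul]
      simp [pow_succ, smul_smul, mul_comm]
    rw [Fin.prod_univ_castSucc, ih, mul_add, mul_one, ← hshift]
    simp only [esymm, add_smul, Finset.sum_add_distrib]
    rw [Finset.sum_range_succ (fun p : ℕ => esymm _ (p : ℤ) • s ^ p) (m + 1), hlast, zero_smul,
      add_zero]

variable {S : Type*} [CommRing S] (f : R →+* S)

theorem map_hsymm (x : Fin m → R) (r : ℤ) : f (hsymm x r) = hsymm (fun i => f (x i)) r := by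
  induction m generalizing r with
  | zero => simp [hsymm, Pi.single_apply, apply_ite f]
  | succ m ih => simp [hsymm, ih]

theorem map_esymm (y : Fin m → R) (r : ℤ) : f (esymm y r) = esymm (fun j => f (y j)) r := by
  induction m generalizing r with
  | zero => simp [esymm, Pi.single_apply, apply_ite f]
  | succ m ih => simp [esymm, ih]

end Symm

/-! ### Minors of one-variable transfer matrices -/

section Minors

variable {R : Type*} [CommRing R] {N : ℕ}

theorem det_eq_mul_of_column_zero (A : Matrix (Fin (N + 1)) (Fin (N + 1)) R)
    (h : ∀ i : Fin N, A i.succ 0 = 0) :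
    A.det = A 0 0 * (A.submatrix Fin.succ Fin.succ).det := by
  simp [Matrix.det_succ_column_zero, Fin.sum_univ_succ, h]

theorem det_eq_mul_of_row_zero (A : Matrix (Fin (N + 1)) (Fin (N + 1)) R)
    (h : ∀ i : Fin N, A 0 i.succ = 0) :
    A.det = A 0 0 * (A.submatrix Fin.succ Fin.succ).det := by
  simp [Matrix.det_succ_row_zero, Fin.sum_univ_succ, h]

theorem det_eq_zero_of_row_eq_smul {ι : Type*} [Fintype ι] [DecidableEq ι] {A : Matrix ι ι R}
    {i j : ι} (hij : i ≠ j) {c : R} (h : A i = c • A j) : A.det = 0 := by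
  rw [← A.updateRow_eq_self i, h, Matrix.det_updateRow_smul,
    Matrix.det_zero_of_row_eq hij (by simp [hij.symm]), mul_zero]

/-- A permutation cannot send the `i + 1` indices `q ≤ i` to the `i` indices `p < i`. -/
theorem det_eq_zero_of_zero_block {A : Matrix (Fin N) (Fin N) R} (i : Fin N)
    (h : ∀ p q, i ≤ p → q ≤ i → A p q = 0) : A.det = 0 := by
  rw [Matrix.det_apply]
  refine Finset.sum_eq_zero fun σ _ => ?_
  obtain ⟨q, hq, hσ⟩ : ∃ q, q ≤ i ∧ i ≤ σ q := by
    by_contra! hlt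
    have hcard := Finset.card_le_card_of_injOn (s := Finset.Iic i) (t := Finset.Iio i) σ
      (fun q hq => by simpa using hlt q (by simpa using hq)) σ.injective.injOn
    simp at hcard
  rw [Finset.prod_eq_zero (f := fun j => A (σ j) j) (Finset.mem_univ q) (h _ _ hσ hq), smul_zero]

/-- The complete homogeneous symmetric polynomial `h_r(t)` of a single variable. -/
def hsymm₁ (t : R) (r : ℤ) : R := if 0 ≤ r then t ^ r.toNat else 0

/-- The elementary symmetric polynomial `e_r(t)` of a single variable. -/
def esymm₁ (t : R) (r : ℤ) : R := if r = 0 then 1 else if r = 1 then t else 0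

variable (t : R) {a b : Fin N → ℤ}

theorem det_hsymm₁_eq_prod (hle : ∀ i, b i ≤ a i) (hlt : ∀ i i', i < i' → a i' < b i) :
    Matrix.det (Matrix.of fun i j => hsymm₁ t (a i - b j)) = ∏ i, t ^ (a i - b i).toNat := by
  have htri : (Matrix.of fun i j => hsymm₁ t (a i - b j)).IsUpperTriangular :=
    fun i j (hij : j < i) => if_neg (by grind)
  rw [Matrix.det_of_isUpperTriangular htri]
  exact Finset.prod_congr rfl fun i _ => if_pos (by grind)

/-- At the first `i` violating the interlacing, row `i` is proportional to a later row. -/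
theorem det_hsymm₁_eq_zero_of_le (ha : StrictAnti a) (hb : StrictAnti b) {i i' : Fin N}
    (hi : i < i') (h : b i ≤ a i') :
    Matrix.det (Matrix.of fun i j => hsymm₁ t (a i - b j)) = 0 := by
  induction i using WellFoundedLT.induction generalizing i' with
  | ind i ih =>
    by_cases hmin : ∃ q < i, b q ≤ a i
    · obtain ⟨q, hq, hle⟩ := hmin
      exact ih q hq hq hle
    refine det_eq_zero_of_row_eq_smul hi.ne (c := t ^ (a i - a i').toNat) (funext fun q => ?_)
    have hai := ha hi
    rcases lt_or_ge q i with hq | hq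
    · have : a i < b q := not_le.1 fun hle => hmin ⟨q, hq, hle⟩
      simp [hsymm₁, show ¬ b q ≤ a i by lia, show ¬ b q ≤ a i' by lia]
    · have := hb.antitone hq
      simp only [hsymm₁, Matrix.of_apply, Pi.smul_apply, smul_eq_mul]
      rw [if_pos (by lia), if_pos (by lia), ← pow_add]
      congr 1
      lia

open Classical in
theorem det_hsymm₁ (ha : StrictAnti a) (hb : StrictAnti b) :
    Matrix.det (Matrix.of fun i j => hsymm₁ t (a i - b j)) =
      if (∀ i, b i ≤ a i) ∧ ∀ i i', i < i' → a i' < b i then ∏ i, t ^ (a i - b i).toNat else 0 := by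
  split_ifs with h
  · exact det_hsymm₁_eq_prod t h.1 h.2
  by_cases hle : ∀ i, b i ≤ a i
  · obtain ⟨i, i', hi, h'⟩ : ∃ i i', i < i' ∧ b i ≤ a i' := by
      by_contra! hlt
      exact h ⟨hle, hlt⟩
    exact det_hsymm₁_eq_zero_of_le t ha hb hi h'
  · push Not at hle
    obtain ⟨i, hi⟩ := hle
    refine det_eq_zero_of_zero_block i fun p q hp hq => if_neg ?_
    have := ha.antitone hp
    have := hb.antitone hq
    lia

theorem det_esymm₁_eq_prod (ha : StrictAnti a) (hb : StrictAnti b)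
    (h : ∀ i, b i ≤ a i ∧ a i ≤ b i + 1) :
    Matrix.det (Matrix.of fun i j => esymm₁ t (a i - b j)) = ∏ i, t ^ (a i - b i).toNat := by
  induction N with
  | zero => simp
  | succ N ih =>
    have hsucc : ((Matrix.of fun i j => esymm₁ t (a i - b j)).submatrix Fin.succ Fin.succ).det =
        ∏ i : Fin N, t ^ (a i.succ - b i.succ).toNat :=
      ih (ha.comp_strictMono Fin.strictMono_succ) (hb.comp_strictMono Fin.strictMono_succ)
        fun i => h i.succ
    rw [Fin.prod_univ_succ, ← hsucc]
    rcases eq_or_ne (a 0) (b 0) with h0 | h0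
    · rw [det_eq_mul_of_column_zero]
      · simp [h0, esymm₁]
      · intro i
        have := ha (Fin.succ_pos i)
        simp [esymm₁, show a i.succ - b 0 ≠ 0 by lia, show a i.succ - b 0 ≠ 1 by lia]
    · have h1 : a 0 = b 0 + 1 := by have := h 0; lia
      rw [det_eq_mul_of_row_zero]
      · simp [h1, esymm₁]
      · intro i
        have := hb (Fin.succ_pos i)
        simp [esymm₁, show a 0 - b i.succ ≠ 0 by lia, show a 0 - b i.succ ≠ 1 by lia]

open Classical in
theorem det_esymm₁ (ha : StrictAnti a) (hb : StrictAnti b) :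
    Matrix.det (Matrix.of fun i j => esymm₁ t (a i - b j)) =
      if ∀ i, b i ≤ a i ∧ a i ≤ b i + 1 then ∏ i, t ^ (a i - b i).toNat else 0 := by
  split_ifs with h
  · exact det_esymm₁_eq_prod t ha hb h
  obtain ⟨i, hi⟩ : ∃ i, a i < b i ∨ b i + 1 < a i := by grind
  rcases hi with hi | hi
  · refine det_eq_zero_of_zero_block i fun p q hp hq => ?_
    have := ha.antitone hp
    have := hb.antitone hq
    simp [esymm₁, show a p - b q ≠ 0 by lia, show a p - b q ≠ 1 by lia]
  · rw [← Matrix.det_transpose]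
    refine det_eq_zero_of_zero_block i fun p q hp hq => ?_
    have := ha.antitone hq
    have := hb.antitone hp
    simp [esymm₁, show a q - b p ≠ 0 by lia, show a q - b p ≠ 1 by lia]

end Minors

/-! ### The Jacobi–Trudi formulas -/

theorem coord_bot (i : ℕ) : coord ⊥ i = -i := by
  have : (⊥ : YoungDiagram) ∈ boxDiagrams 0 0 :=
    mem_boxDiagrams.2 fun _ _ h => absurd h (YoungDiagram.notMem_bot _)
  exact coord_eq_neg this (Nat.zero_le i)

theorem coord_fin_strictAnti (lam : YoungDiagram) (N : ℕ) :
    StrictAnti fun i : Fin N => coord lam i :=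
  fun _ _ hij => coord_strictAnti lam hij

theorem det_single_coord {N k : ℕ} {lam : YoungDiagram} (hl : lam ∈ boxDiagrams N k)
    [Decidable (lam = ⊥)] :
    Matrix.det (Matrix.of fun i j : Fin N => (Pi.single 0 1 : ℤ → ℝ) (coord lam i + j)) =
      if lam = ⊥ then 1 else 0 := by
  split_ifs with h
  · subst h
    convert Matrix.det_one (n := Fin N) (R := ℝ) using 2
    ext i j
    simp [coord_bot, Pi.single_apply, Matrix.one_apply, neg_add_eq_zero, Fin.ext_iff]
  · obtain ⟨⟨p, q⟩, hc⟩ := exists_mem_of_ne_bot h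
    have hN := (mem_boxDiagrams.1 hl p q hc).1
    have h0 : 0 < lam.rowLen 0 := YoungDiagram.mem_iff_lt_rowLen.1
      (lam.up_left_mem (Nat.zero_le _) (Nat.zero_le _) hc)
    refine Matrix.det_eq_zero_of_row_eq_zero ⟨0, by lia⟩ fun j => ?_
    exact Pi.single_eq_of_ne (by simp only [coord]; lia) _

theorem hsymm_coord_eq_sum {R : Type*} [CommRing R] {N k m : ℕ} (x : Fin (m + 1) → R)
    {lam : YoungDiagram} (hl : lam ∈ boxDiagrams N k) (i j : Fin N) :
    hsymm x (coord lam i + j) = ∑ b ∈ Finset.Icc (1 - (N : ℤ)) k,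
      hsymm₁ (x (Fin.last m)) (coord lam i - b) * hsymm (fun p => x p.castSucc) (b + j) := by
  have hk := (Finset.mem_Icc.1 (coord_mem_Icc hl i)).2
  have hj := j.isLt
  simp only [hsymm₁, sub_nonneg, ite_mul, zero_mul]
  rw [hsymm_succ_eq_sum x (show 1 - (N : ℤ) + j ≤ 0 by lia), ← Finset.sum_filter]
  refine Finset.sum_congr ?_ fun _ _ => rfl
  grind

theorem esymm_coord_eq_sum {R : Type*} [CommRing R] {N k m : ℕ} (y : Fin (m + 1) → R)
    {lam : YoungDiagram} (hl : lam ∈ boxDiagrams N k) (i j : Fin N) :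
    esymm y (coord lam i + j) = ∑ b ∈ Finset.Icc (1 - (N : ℤ)) k,
      esymm₁ (y (Fin.last m)) (coord lam i - b) * esymm (fun p => y p.castSucc) (b + j) := by
  have hc := Finset.mem_Icc.1 (coord_mem_Icc hl i)
  have hsplit (b : ℤ) : esymm₁ (y (Fin.last m)) (coord lam i - b) =
      (if b = coord lam i then 1 else 0) + if b = coord lam i - 1 then y (Fin.last m) else 0 := by
    unfold esymm₁
    grind
  simp only [hsplit, add_mul, Finset.sum_add_distrib, ite_mul, one_mul, zero_mul,
    Finset.sum_ite_eq', coord_mem_Icc hl i, if_true]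
  rw [esymm, show coord lam i + j - 1 = coord lam i - 1 + j by ring]
  congr 1
  split_ifs with h
  · rfl
  · rw [esymm_of_neg _ (by grind), mul_zero]

theorem schur_eq_det_hsymm {N k m : ℕ} (x : Fin m → ℝ) {lam : YoungDiagram}
    (hl : lam ∈ boxDiagrams N k) :
    schur lam x = Matrix.det (Matrix.of fun i j : Fin N => hsymm x (coord lam i + j)) := by
  classical
  induction m generalizing lam with
  | zero => exact (schur_fin_zero lam x).trans (det_single_coord hl).symm
  | succ m ih =>
    simp only [hsymm_coord_eq_sum x hl]
    rw [det_sum_mul_eq_sum_boxDiagrams N k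
        (fun i b => hsymm₁ (x (Fin.last m)) (coord lam i - b))
        (fun j b => hsymm (fun p => x p.castSucc) (b + j)), schur_succ hl, Finset.sum_filter]
    refine Finset.sum_congr rfl fun mu hm => ?_
    rw [det_hsymm₁ _ (coord_fin_strictAnti lam N)
      (coord_fin_strictAnti mu N), ← Matrix.det_transpose, ih _ hm]
    simp only [isHorizontalStrip_iff_coord hl hm]
    split_ifs with h
    · rw [Finset.prod_pow_eq_pow_sum]
      congr 2
      exact (sum_toNat_coord_sub hl hm h.1).symm
    · exact (zero_mul _).symm

theorem sum_boxDiagrams_transpose {M : Type*} [AddCommMonoid M] (n k : ℕ) (F : YoungDiagram → M) :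
    ∑ mu ∈ boxDiagrams k n, F mu = ∑ mu ∈ boxDiagrams n k, F mu.transpose :=
  Finset.sum_bij' (fun mu _ => mu.transpose) (fun mu _ => mu.transpose)
    (fun _ h => transpose_mem_boxDiagrams.2 h) (fun _ h => transpose_mem_boxDiagrams.2 h)
    (by simp) (by simp) (by simp)

theorem card_transpose (lam : YoungDiagram) : lam.transpose.card = lam.card := by
  simp [YoungDiagram.card, YoungDiagram.transpose]

theorem schur_transpose_eq_det_esymm {N k m : ℕ} (y : Fin m → ℝ) {lam : YoungDiagram}
    (hl : lam ∈ boxDiagrams N k) :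
    schur lam.transpose y =
      Matrix.det (Matrix.of fun i j : Fin N => esymm y (coord lam i + j)) := by
  classical
  induction m generalizing lam with
  | zero =>
    have hbot : lam.transpose = ⊥ ↔ lam = ⊥ := YoungDiagram.transpose_eq_iff_eq_transpose
    exact (schur_fin_zero _ y).trans ((if_congr hbot rfl rfl).trans (det_single_coord hl).symm)
  | succ m ih =>
    simp only [esymm_coord_eq_sum y hl]
    rw [det_sum_mul_eq_sum_boxDiagrams N k
        (fun i b => esymm₁ (y (Fin.last m)) (coord lam i - b))
        (fun j b => esymm (fun p => y p.castSucc) (b + j)),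
      schur_succ (transpose_mem_boxDiagrams.2 hl), Finset.sum_filter, sum_boxDiagrams_transpose]
    refine Finset.sum_congr rfl fun mu hm => ?_
    rw [det_esymm₁ _ (coord_fin_strictAnti lam N)
      (coord_fin_strictAnti mu N), ← Matrix.det_transpose, ih _ hm]
    simp only [isHorizontalStrip_transpose_iff_coord hl hm, card_transpose]
    split_ifs with h
    · rw [Finset.prod_pow_eq_pow_sum]
      congr 2
      exact (sum_toNat_coord_sub hl hm fun i => (h i).1).symm
    · exact (zero_mul _).symm

/-! ### Linear recurrences -/

section Recurrence

open LaurentPolynomial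

variable {R : Type*} [CommRing R] {n m k : ℕ}

variable (R) in
/-- Laurent polynomials acting on sequences as difference operators: `T c` is the shift
`u ↦ u (· + c)`. -/
def shiftAction : R[T;T⁻¹] →ₐ[R] Module.End R (ℤ → R) :=
  AddMonoidAlgebra.lift R (Module.End R (ℤ → R)) ℤ
    { toFun := fun c => LinearMap.funLeft R R (· + c.toAdd)
      map_one' := by ext; simp [LinearMap.funLeft]
      map_mul' := fun c d => by ext; simp [LinearMap.funLeft, add_assoc] }

theorem shiftAction_T (c : ℤ) (u : ℤ → R) (a : ℤ) : shiftAction R (T c) u a = u (a + c) := by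
  rw [shiftAction, T, AddMonoidAlgebra.lift_single, one_smul]
  rfl

/-- The Laurent polynomial `∏ (1 + y_j T^c)`. -/
def linearProd (y : Fin m → R) (c : ℤ) : R[T;T⁻¹] := ∏ j, (1 + y j • T c)

theorem shiftAction_one_add_smul_T (t : R) (c : ℤ) (u : ℤ → R) (a : ℤ) :
    shiftAction R (1 + t • T c) u a = u a + t * u (a + c) := by
  simp [shiftAction_T]

theorem shiftAction_linearProd (y : Fin m → R) (c : ℤ) (u : ℤ → R) (a : ℤ) :
    shiftAction R (linearProd y c) u a =
      ∑ p ∈ Finset.range (m + 1), esymm y p * u (a + p * c) := by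
  simp [linearProd, prod_one_add_smul, T_pow, LinearMap.sum_apply, shiftAction_T]

theorem shiftAction_comm (p q : R[T;T⁻¹]) (u : ℤ → R) :
    shiftAction R p (shiftAction R q u) = shiftAction R q (shiftAction R p u) := by
  rw [← Module.End.mul_apply, ← map_mul, mul_comm, map_mul, Module.End.mul_apply]

theorem shiftAction_shift (p : R[T;T⁻¹]) (u : ℤ → R) (t a : ℤ) :
    shiftAction R p (fun b => u (b + t)) a = shiftAction R p u (a + t) := by
  have h (v : ℤ → R) : (fun b => v (b + t)) = shiftAction R (T t) v :=
    funext fun b => (shiftAction_T t v b).symm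
  rw [h, shiftAction_comm, shiftAction_T]

theorem shiftAction_hsymm (x : Fin n → R) :
    shiftAction R (linearProd (-x) (-1)) (hsymm x) = Pi.single 0 1 := by
  induction n with
  | zero =>
    rw [linearProd, Finset.univ_eq_empty, Finset.prod_empty, map_one]
    rfl
  | succ n ih =>
    have hlast : shiftAction R (1 + (-x) (Fin.last n) • T (-1)) (hsymm x) =
        hsymm fun i => x i.castSucc := funext fun r => by
      rw [shiftAction_one_add_smul_T, hsymm_succ x r, Pi.neg_apply]
      ring_nf
    rw [linearProd, Fin.prod_univ_castSucc, map_mul, Module.End.mul_apply, hlast]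
    exact ih _

theorem eq_zero_of_forward {x : Fin n → R} {d : ℤ → R} {b : ℤ}
    (h : ∀ a ≥ b, shiftAction R (linearProd x (-1)) d a = 0)
    (h₀ : ∀ a, b - n ≤ a → a < b → d a = 0) {a : ℤ} (ha : b - n ≤ a) : d a = 0 := by
  suffices H : ∀ N : ℕ, ∀ a, b - n ≤ a → a < b + N → d a = 0 from
    H (a + 1 - b).toNat a ha (by lia)
  intro N
  induction N with
  | zero => simpa using h₀
  | succ N ih =>
    intro a ha haN
    by_cases hlt : a < b + N
    · exact ih a ha hlt
    have hrec := h a (by lia)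
    rwa [shiftAction_linearProd, Finset.sum_eq_single_of_mem 0 (by simp), Nat.cast_zero,
      esymm_zero, one_mul, zero_mul, add_zero] at hrec
    intro p hp hp0
    rw [ih _ (by grind) (by lia), mul_zero]

theorem eq_zero_of_backward {y : Fin k → R} {d : ℤ → R}
    (h : shiftAction R (linearProd y 1) d = 0) (h₀ : ∀ a ≥ 1, d a = 0) : d = 0 := by
  suffices H : ∀ N : ℕ, ∀ a ≥ 1 - (N : ℤ), d a = 0 from
    funext fun a => H (1 - a).toNat a (by lia)
  intro N
  induction N with
  | zero => simpa using h₀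
  | succ N ih =>
    intro a ha
    have hrec := congrFun h a
    rwa [shiftAction_linearProd, Finset.sum_eq_single_of_mem 0 (by simp), Nat.cast_zero,
      esymm_zero, one_mul, zero_mul, add_zero] at hrec
    intro p _ hp0
    rw [ih _ (by lia), mul_zero]

theorem hsymm_eq_of_shiftAction_eq {x : Fin n → R} {f : ℤ → R}
    (h : shiftAction R (linearProd (-x) (-1)) f = Pi.single 0 1) (h₀ : ∀ a < 0, f a = 0) :
    f = hsymm x := by
  refine sub_eq_zero.1 (funext fun a => ?_)
  have hneg (a : ℤ) (ha : a < 0) : (f - hsymm x) a = 0 := by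
    rw [Pi.sub_apply, h₀ a ha, hsymm_of_neg x ha, sub_zero]
  rcases lt_or_ge a 0 with ha | ha
  · exact hneg a ha
  refine eq_zero_of_forward (x := -x) (b := 0) (fun a _ => ?_) (fun a _ => hneg a) (by lia)
  rw [map_sub, h, shiftAction_hsymm, sub_self, Pi.zero_apply]

end Recurrence

/-! ### Laurent coefficients of the symbol -/

section SymbolCoeff

open LaurentPolynomial

variable {R : Type*} [CommRing R] {n k : ℕ} {x : Fin n → R} {y : Fin k → R} {u v : ℤ → R}

/-- The relations satisfied by the Laurent coefficients `u_a` of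
`K(z) = ∏ (1 - x_i z)⁻¹ ∏ (1 + y_j / z)⁻¹` on an annulus `|y_j| < |z| < |x_i|⁻¹`: multiplying by
`∏ (1 + y_j / z)` leaves the generating function of the `h_r(x)`, and multiplying by
`∏ (1 - x_i z)` leaves a power series in `1 / z`. -/
structure IsSymbolCoeff (x : Fin n → R) (y : Fin k → R) (u : ℤ → R) : Prop where
  forward : ∀ a ≥ 1, shiftAction R (linearProd (-x) (-1)) u a = 0
  backward : shiftAction R (linearProd y 1) u = hsymm x

theorem isCoprime_linearProd (hxy : ∀ i j, IsUnit (1 + x i * y j)) :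
    IsCoprime (linearProd (-x) (-1)) (linearProd y 1) := by
  refine IsCoprime.prod_left fun i _ => IsCoprime.prod_right fun j _ => ?_
  obtain ⟨c, hc⟩ := (hxy i j).exists_left_inv
  refine ⟨C c, C c * (x i • T (-1)), ?_⟩
  have hT : (T (-1) * T 1 : R[T;T⁻¹]) = 1 := by rw [← T_add, neg_add_cancel, T_zero]
  calc C c * (1 + (-x) i • T (-1)) + C c * (x i • T (-1)) * (1 + y j • T 1)
      = C c * (1 + C (x i) * C (y j) * (T (-1) * T 1)) := by
        simp only [Pi.neg_apply, smul_eq_C_mul, map_neg]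
        ring
    _ = 1 := by rw [hT, mul_one, ← map_mul, ← map_one C, ← map_add, ← map_mul, hc]

/-- The two recurrences of a difference of solutions are homogeneous, and their symbols are
coprime. -/
theorem IsSymbolCoeff.unique (hu : IsSymbolCoeff x y u) (hv : IsSymbolCoeff x y v)
    (hxy : ∀ i j, IsUnit (1 + x i * y j)) : u = v := by
  have hbackward : shiftAction R (linearProd y 1) (u - v) = 0 := by
    rw [map_sub, hu.backward, hv.backward, sub_self]
  have hforward : shiftAction R (linearProd (-x) (-1)) (u - v) = 0 := by
    refine eq_zero_of_backward (y := y) ?_ fun a ha => ?_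
    · rw [shiftAction_comm, hbackward, map_zero]
    · rw [map_sub, Pi.sub_apply, hu.forward a ha, hv.forward a ha, sub_self]
  obtain ⟨p, q, hpq⟩ := isCoprime_linearProd hxy
  rw [← sub_eq_zero, ← Module.End.one_apply (R := R) (u - v), ← map_one (shiftAction R), ← hpq,
    map_add, map_mul, map_mul, LinearMap.add_apply, Module.End.mul_apply, Module.End.mul_apply,
    hforward, hbackward, map_zero, map_zero, add_zero]

/-! ### Toeplitz determinants -/

theorem det_hsymm_sub (x : Fin n → R) (N : ℕ) :
    (Matrix.of fun i j : Fin N => hsymm x ((j : ℤ) - i)).det = 1 := by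
  have htri : (Matrix.of fun i j : Fin N => hsymm x ((j : ℤ) - i)).IsUpperTriangular :=
    fun i j (hji : j < i) => hsymm_of_neg x (by have : (j : ℕ) < i := hji; lia)
  rw [Matrix.det_of_isUpperTriangular htri]
  simp [hsymm_zero]

/-- Above `-n`, a solution of the recurrence is a combination of the `n` solutions
`a ↦ h_{a + j}(x)`. -/
theorem det_eq_det_hsymm_mul (hu : ∀ a ≥ 1, shiftAction R (linearProd (-x) (-1)) u a = 0)
    {c : Fin n → ℤ} (hc : ∀ i, 1 - (n : ℤ) ≤ c i) :
    (Matrix.of fun i t : Fin n => u (c i + t)).det =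
      (Matrix.of fun i j : Fin n => hsymm x (c i + j)).det *
        (Matrix.of fun i t : Fin n => u ((t : ℤ) - i)).det := by
  set H₀ := Matrix.of fun i j : Fin n => hsymm x ((j : ℤ) - i) with hH₀
  set U₀ := Matrix.of fun i t : Fin n => u ((t : ℤ) - i) with hU₀
  have hdet : H₀.det = 1 := det_hsymm_sub x n
  set Q := H₀⁻¹ * U₀ with hQ
  have hmul : H₀ * Q = U₀ := by rw [hQ, Matrix.mul_nonsing_inv_cancel_left _ _ (by simp [hdet])]
  have hexpand (t : Fin n) {a : ℤ} (ha : 1 - (n : ℤ) ≤ a) :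
      u (a + t) = ∑ j : Fin n, hsymm x (a + j) * Q j t := by
    let d : ℤ → R := (fun b => u (b + t)) - ∑ j : Fin n, Q j t • fun b => hsymm x (b + j)
    have hd (b : ℤ) : d b = u (b + t) - ∑ j : Fin n, hsymm x (b + j) * Q j t := by
      simp [d, mul_comm]
    rw [← sub_eq_zero, ← hd]
    refine eq_zero_of_forward (x := -x) (fun b hb => ?_) (fun b hb hb1 => ?_) ha
    · simp only [d, map_sub, map_sum, map_smul, Pi.sub_apply, Finset.sum_apply, Pi.smul_apply,
        shiftAction_shift, shiftAction_hsymm, hu (b + t) (by lia)]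
      simp [show ∀ j : Fin n, b + j ≠ 0 by lia]
    · obtain ⟨i, hi⟩ : ∃ i : Fin n, -(i : ℤ) = b := ⟨⟨(-b).toNat, by lia⟩, by simp; lia⟩
      have hentry := congrFun (congrFun hmul i) t
      simp only [Matrix.mul_apply, hH₀, hU₀, Matrix.of_apply, sub_eq_neg_add, hi] at hentry
      rw [hd, hentry, sub_self]
  rw [← hmul, Matrix.det_mul, hdet, one_mul, ← Matrix.det_mul]
  congr 1
  ext i t
  simp [Matrix.mul_apply, hexpand t (hc i)]

theorem prod_one_add_mul (x : Fin n → R) (s : R) :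
    ∏ i, (1 + x i * s) = ∑ p ∈ Finset.range (n + 1), esymm x p * s ^ p :=
  prod_one_add_smul x s

/-- The matrix `C` with `u_{a + 1} = C u_a` for the state vectors `u_a = (u (a), …, u (a - n + 1))`
of a solution of the recurrence with symbol `∏ (1 - x_i T⁻¹)`. -/
def companion (x : Fin n → R) : Matrix (Fin n) (Fin n) R :=
  Matrix.of fun i q => if (i : ℕ) = 0 then -esymm (-x) (q + 1) else if (i : ℕ) = q + 1 then 1 else 0

theorem companion_mulVec_zero (x : Fin (n + 1) → R) (v : Fin (n + 1) → R) :
    (companion x).mulVec v 0 = -∑ q : Fin (n + 1), esymm (-x) (q + 1) * v q := by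
  simp [Matrix.mulVec, dotProduct, companion]

theorem companion_mulVec_succ (x : Fin (n + 1) → R) (v : Fin (n + 1) → R) (i : Fin n) :
    (companion x).mulVec v i.succ = v i.castSucc := by
  have hval (q : Fin (n + 1)) : (i : ℕ) = q ↔ i.castSucc = q := by
    rw [Fin.ext_iff, Fin.val_castSucc]
  simp [Matrix.mulVec, dotProduct, companion, hval]

theorem one_add_smul_companion_mulVec (x : Fin (n + 1) → R) (t : R) :
    (1 + t • companion x).mulVec (fun q => (-t) ^ (q : ℕ)) = Pi.single 0 (∏ i, (1 + x i * t)) := by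
  refine funext fun i => ?_
  rw [Matrix.add_mulVec, Matrix.one_mulVec, Matrix.smul_mulVec, Pi.add_apply, Pi.smul_apply,
    smul_eq_mul]
  refine Fin.cases ?_ (fun i => ?_) i
  · have hprod := prod_one_add_mul (-x) (-t)
    simp only [Pi.neg_apply, neg_mul_neg] at hprod
    rw [Pi.single_eq_same, hprod, Finset.sum_range_succ', Nat.cast_zero, esymm_zero, pow_zero,
      ← Fin.sum_univ_eq_sum_range fun p => esymm (-x) ((p + 1 : ℕ) : ℤ) * (-t) ^ (p + 1),
      companion_mulVec_zero, mul_neg, Finset.mul_sum, ← Finset.sum_neg_distrib, add_comm]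
    refine congrArg₂ _ (Finset.sum_congr rfl fun p _ => ?_) (by simp)
    push_cast
    ring
  · rw [Pi.single_eq_of_ne (Fin.succ_ne_zero i), companion_mulVec_succ, Fin.val_succ,
      Fin.val_castSucc]
    ring

/-- Replacing the first column of `1 + t C` by `(1 + t C) v`, where `v = ((-t) ^ q)_q` starts with
`1`, does not change the determinant. -/
theorem det_one_add_smul_companion (x : Fin n → R) (t : R) :
    (1 + t • companion x).det = ∏ i, (1 + x i * t) := by
  rcases n with _ | N
  · simp
  set M := 1 + t • companion x with hM
  set M' := M.updateCol 0 (M.mulVec fun q => (-t) ^ (q : ℕ)) with hM'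
  have hdet : M'.det = M.det := by
    have hsum := Matrix.det_updateCol_sum M 0 fun q => (-t) ^ (q : ℕ)
    simp only [smul_eq_mul, Fin.val_zero, pow_zero, one_mul] at hsum
    rw [← hsum, hM']
    congr 2
    exact funext fun i => dotProduct_comm _ _
  have hcolumn (i : Fin (N + 1)) :
      M' i 0 = (Pi.single 0 (∏ i, (1 + x i * t)) : Fin (N + 1) → R) i := by
    rw [hM', Matrix.updateCol_self, hM, one_add_smul_companion_mulVec]
  have hminor : (M'.submatrix Fin.succ Fin.succ).det = 1 := by
    have hentry (i q : Fin N) : M' i.succ q.succ =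
        (if i = q then 1 else 0) + t * if (i : ℕ) = q + 1 then 1 else 0 := by
      rw [hM', Matrix.updateCol_ne (Fin.succ_ne_zero q)]
      simp [hM, companion, Matrix.one_apply]
    have htri : (M'.submatrix Fin.succ Fin.succ).IsLowerTriangular := by
      intro i q (hiq : i < q)
      rw [Matrix.submatrix_apply, hentry, if_neg hiq.ne, if_neg (by lia), mul_zero, add_zero]
    rw [Matrix.det_of_isLowerTriangular _ htri]
    exact Finset.prod_eq_one fun i _ => by simp [hentry]
  rw [← hdet, det_eq_mul_of_column_zero _ fun i => by simp [hcolumn], hminor, mul_one, hcolumn,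
    Pi.single_eq_same]

theorem det_shiftAction_one_add_smul_T
    (hu : ∀ a ≥ 1, shiftAction R (linearProd (-x) (-1)) u a = 0) (t : R) :
    (Matrix.of fun i j : Fin n => shiftAction R (1 + t • T 1) u ((j : ℤ) - i)).det =
      (∏ i, (1 + x i * t)) * (Matrix.of fun i j : Fin n => u ((j : ℤ) - i)).det := by
  rcases n with _ | N
  · simp
  rw [← det_one_add_smul_companion, ← Matrix.det_mul, add_mul, one_mul, smul_mul_assoc]
  congr 1
  ext i j
  set U := Matrix.of fun i j : Fin (N + 1) => u ((j : ℤ) - i) with hU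
  have hstate : (companion x).mulVec (fun q => U q j) i = u (j - i + 1) := by
    refine Fin.cases ?_ (fun i => ?_) i
    · have hrec := hu ((j : ℤ) + 1) (by lia)
      rw [shiftAction_linearProd, Finset.sum_range_succ', Nat.cast_zero, esymm_zero, one_mul,
        zero_mul, add_zero, ← Fin.sum_univ_eq_sum_range fun p =>
          esymm (-x) ((p + 1 : ℕ) : ℤ) * u ((j : ℤ) + 1 + (p + 1 : ℕ) * -1)] at hrec
      rw [companion_mulVec_zero, Fin.val_zero, Nat.cast_zero, sub_zero,
        eq_comm, ← add_eq_zero_iff_eq_neg', ← hrec]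
      congr 1
      refine Finset.sum_congr rfl fun q _ => ?_
      rw [hU, Matrix.of_apply]
      push_cast
      ring_nf
    · rw [companion_mulVec_succ, hU, Matrix.of_apply, Fin.val_castSucc, Fin.val_succ]
      push_cast
      ring_nf
  rw [Matrix.of_apply, shiftAction_one_add_smul_T, Matrix.add_apply, Matrix.smul_apply, ← hstate]
  rfl

theorem det_shiftAction_linearProd
    (hu : ∀ a ≥ 1, shiftAction R (linearProd (-x) (-1)) u a = 0) (y : Fin k → R) :
    (Matrix.of fun i j : Fin n => shiftAction R (linearProd y 1) u ((j : ℤ) - i)).det =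
      (∏ i, ∏ j, (1 + x i * y j)) * (Matrix.of fun i j : Fin n => u ((j : ℤ) - i)).det := by
  induction k generalizing u with
  | zero => simp [linearProd]
  | succ k ih =>
    have hstep (a : ℤ) (ha : a ≥ 1) : shiftAction R (linearProd (-x) (-1))
        (shiftAction R (1 + y (Fin.last k) • T 1) u) a = 0 := by
      rw [shiftAction_comm, shiftAction_one_add_smul_T, hu a ha, hu (a + 1) (by lia), mul_zero,
        add_zero]
    have hprod : shiftAction R (linearProd y 1) u = shiftAction R
        (linearProd (fun j => y j.castSucc) 1) (shiftAction R (1 + y (Fin.last k) • T 1) u) := by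
      rw [← Module.End.mul_apply, ← map_mul, linearProd, Fin.prod_univ_castSucc, linearProd]
    rw [hprod, ih hstep, det_shiftAction_one_add_smul_T hu]
    simp only [Fin.prod_univ_castSucc, Finset.prod_mul_distrib]
    ring

theorem IsSymbolCoeff.prod_mul_det (hu : IsSymbolCoeff x y u) :
    (∏ i, ∏ j, (1 + x i * y j)) * (Matrix.of fun i j : Fin n => u ((j : ℤ) - i)).det = 1 := by
  rw [← det_shiftAction_linearProd hu.forward, hu.backward, det_hsymm_sub]

end SymbolCoeff

/-! ### The correlation kernel -/

theorem sum_fin_eq_finsum {M : Type*} [AddCommMonoid M] {N : ℕ} {g : ℤ → M}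
    (hneg : ∀ a < 0, g a = 0) (hge : ∀ a ≥ (N : ℤ), g a = 0) :
    ∑ l : Fin N, g l = ∑ᶠ a, g a := by
  have hsupp : Function.support g ⊆ ((Finset.range N).map Nat.castEmbedding : Finset ℤ) := by
    intro a ha
    have h0 : 0 ≤ a := not_lt.1 fun h => ha (hneg a h)
    have hN : a < N := not_le.1 fun h => ha (hge a h)
    simpa using ⟨a.toNat, by lia, by lia⟩
  rw [finsum_eq_sum_of_support_subset g hsupp, Finset.sum_map, ← Fin.sum_univ_eq_sum_range
    fun l => g (Nat.castEmbedding l)]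
  rfl

section Kernel

variable {R : Type*} [CommRing R] {n k : ℕ} {x : Fin n → R} {y : Fin k → R} {u : ℤ → R}

theorem sum_esymm_mul_eq_finsum (y : Fin k → R) (g : ℤ → R) :
    ∑ p ∈ Finset.range (k + 1), esymm y p * g p = ∑ᶠ a : ℤ, esymm y a * g a := by
  rw [← sum_fin_eq_finsum (N := k + 1), Fin.sum_univ_eq_sum_range fun p => esymm y p * g p]
  · intro a ha
    rw [esymm_of_neg y ha, zero_mul]
  · intro a ha
    rw [esymm_of_gt y (by lia), zero_mul]

/-- The recurrence `∑ e_i(-x) u (M + l - i)` truncated to `i ≤ l`. For `0 ≤ l < n` this function of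
`M` is the biorthogonal partner of `M ↦ e_{M + l}(y)`. -/
def partner (x : Fin n → R) (u : ℤ → R) (l M : ℤ) : R :=
  ∑ i ∈ Finset.range (n + 1), if (i : ℤ) ≤ l then esymm (-x) i * u (M + l - i) else 0

theorem partner_of_neg (x : Fin n → R) (u : ℤ → R) {l : ℤ} (hl : l < 0) (M : ℤ) :
    partner x u l M = 0 :=
  Finset.sum_eq_zero fun i _ => if_neg (by lia)

theorem partner_of_ge (x : Fin n → R) (u : ℤ → R) {l : ℤ} (hl : n ≤ l) (M : ℤ) :
    partner x u l M = shiftAction R (linearProd (-x) (-1)) u (M + l) := by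
  rw [shiftAction_linearProd]
  refine Finset.sum_congr rfl fun i hi => ?_
  rw [if_pos (by grind), mul_neg_one, sub_eq_add_neg]

theorem partner_eq_sum (x : Fin n → R) (u : ℤ → R) (l : Fin n) (M : ℤ) :
    partner x u l M = ∑ t : Fin n, u (M + t) * esymm (-x) (l - t) := by
  have hpartner := sum_esymm_mul_eq_finsum (-x)
    fun i => if i ≤ (l : ℤ) then u (M + l - i) else 0
  simp only [mul_ite, mul_zero] at hpartner
  rw [partner, hpartner, ← finsum_comp_equiv (Equiv.subLeft (l : ℤ)),
    ← sum_fin_eq_finsum (N := n)]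
  · refine Finset.sum_congr rfl fun t _ => ?_
    rw [Equiv.subLeft_apply, if_pos (by lia), mul_comm]
    ring_nf
  · intro a ha
    rw [Equiv.subLeft_apply, if_neg (by lia)]
  · intro a ha
    have hl : (l : ℤ) < n := mod_cast l.isLt
    rw [Equiv.subLeft_apply, esymm_of_neg _ (by lia), zero_mul, ite_self]

theorem det_partner (x : Fin n → R) (u : ℤ → R) (c : Fin n → ℤ) :
    (Matrix.of fun i l : Fin n => partner x u l (c i)).det =
      (Matrix.of fun i t : Fin n => u (c i + t)).det := by
  have htri : (Matrix.of fun t l : Fin n => esymm (-x) ((l : ℤ) - t)).IsUpperTriangular :=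
    fun t l (hlt : l < t) => esymm_of_neg _ (by have : (l : ℕ) < t := hlt; lia)
  have hdet : (Matrix.of fun t l : Fin n => esymm (-x) ((l : ℤ) - t)).det = 1 := by
    rw [Matrix.det_of_isUpperTriangular htri]
    simp [esymm_zero]
  rw [← mul_one (Matrix.det (Matrix.of fun i t : Fin n => u (c i + t))), ← hdet, ← Matrix.det_mul]
  congr 1
  ext i l
  exact partner_eq_sum x u l (c i)

/-- The correlation kernel as a finite sum: `∑ e_p(y) e_i(-x) u (M - M' + p - i)` over
`p - i ≥ M'`. With `M = m + 1/2`, `M' = m' + 1/2` it is the double integral `𝒦(m, m')`: expand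
`1 / K(w)` into monomials. -/
def kernel (x : Fin n → R) (y : Fin k → R) (u : ℤ → R) (M M' : ℤ) : R :=
  ∑ p ∈ Finset.range (k + 1), esymm y p * partner x u (p - M') M

theorem kernel_of_gt (x : Fin n → R) (y : Fin k → R) (u : ℤ → R) (M : ℤ) {M' : ℤ} (hM' : k < M') :
    kernel x y u M M' = 0 :=
  Finset.sum_eq_zero fun p hp => by rw [partner_of_neg x u (by grind), mul_zero]

theorem IsSymbolCoeff.kernel_of_le (hu : IsSymbolCoeff x y u) (M : ℤ) {M' : ℤ} (hM' : M' ≤ -n) :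
    kernel x y u M M' = if M = M' then 1 else 0 := by
  calc kernel x y u M M'
      = shiftAction R (linearProd y 1) (shiftAction R (linearProd (-x) (-1)) u) (M - M') := by
        rw [shiftAction_linearProd]
        refine Finset.sum_congr rfl fun p _ => ?_
        rw [partner_of_ge x u (by lia), mul_one]
        ring_nf
    _ = if M = M' then 1 else 0 := by
        rw [shiftAction_comm, hu.backward, shiftAction_hsymm, Pi.single_apply]
        simp only [sub_eq_zero]

theorem IsSymbolCoeff.kernel_eq_sum (hu : IsSymbolCoeff x y u) {M : ℤ} (hM : 1 - n ≤ M) (M' : ℤ) :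
    kernel x y u M M' = ∑ l : Fin n, partner x u l M * esymm y (M' + l) := by
  rw [sum_fin_eq_finsum (g := fun l => partner x u l M * esymm y (M' + l)), kernel,
    sum_esymm_mul_eq_finsum y fun p => partner x u (p - M') M,
    ← finsum_comp_equiv (Equiv.addLeft M')]
  · refine finsum_congr fun l => ?_
    rw [Equiv.coe_addLeft, add_sub_cancel_left, mul_comm]
  · intro l hl
    rw [partner_of_neg x u hl, zero_mul]
  · intro l hl
    rw [partner_of_ge x u hl, hu.forward _ (by lia), zero_mul]

theorem IsSymbolCoeff.sum_mul_esymm (hu : IsSymbolCoeff x y u) (b : ℤ) (j : Fin n) :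
    ∑ a ∈ Finset.Icc (1 - (n : ℤ)) k, u (a + b) * esymm y (a + j) = hsymm x (b - j) := by
  have hsupp : (Function.support fun a : ℤ => u (a + b) * esymm y (a + j)) ⊆
      Finset.Icc (1 - (n : ℤ)) k := by
    intro a ha
    have hne : esymm y (a + j) ≠ 0 := right_ne_zero_of_mul ha
    have h0 : 0 ≤ a + j := not_lt.1 fun h => hne (esymm_of_neg y h)
    have hk : a + j ≤ k := not_lt.1 fun h => hne (esymm_of_gt y h)
    have hj : (j : ℤ) < n := mod_cast j.isLt
    simpa using ⟨by lia, by lia⟩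
  rw [← finsum_eq_sum_of_support_subset _ hsupp, ← hu.backward, shiftAction_linearProd,
    sum_esymm_mul_eq_finsum y fun p => u (b - j + p * 1),
    ← finsum_comp_equiv (Equiv.subRight (j : ℤ))]
  refine finsum_congr fun a => ?_
  rw [Equiv.subRight_apply, sub_add_cancel, mul_comm]
  ring_nf

theorem IsSymbolCoeff.biorthogonal (hu : IsSymbolCoeff x y u) (l j : Fin n) :
    ∑ a ∈ Finset.Icc (1 - (n : ℤ)) k, partner x u l a * esymm y (a + j) =
      if l = j then 1 else 0 := by
  calc ∑ a ∈ Finset.Icc (1 - (n : ℤ)) k, partner x u l a * esymm y (a + j)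
      = ∑ i ∈ Finset.range (n + 1), if (i : ℤ) ≤ l then
          esymm (-x) i * ∑ a ∈ Finset.Icc (1 - (n : ℤ)) k, u (a + (l - i)) * esymm y (a + j)
        else 0 := by
        simp only [partner, Finset.sum_mul, ite_mul, zero_mul]
        rw [Finset.sum_comm]
        refine Finset.sum_congr rfl fun i _ => ?_
        split_ifs
        · simp only [Finset.mul_sum, mul_assoc, add_sub_assoc]
        · exact Finset.sum_const_zero
    _ = shiftAction R (linearProd (-x) (-1)) (hsymm x) (l - j) := by
        rw [shiftAction_linearProd]
        refine Finset.sum_congr rfl fun i _ => ?_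
        rw [hu.sum_mul_esymm, mul_neg_one]
        split_ifs with hi
        · ring_nf
        · rw [hsymm_of_neg x (by lia), mul_zero]
    _ = if l = j then 1 else 0 := by
        rw [shiftAction_hsymm, Pi.single_apply]
        simp [sub_eq_zero, Fin.ext_iff]

end Kernel

/-! ### Biorthogonal ensembles -/

section Ensemble

open Polynomial

variable {R : Type*} [CommRing R] {N k : ℕ} {ι : Type*} [Fintype ι] {s : ι → ℤ}

variable (R) in
/-- The weight `1 + X` at the points of `s` and `1` elsewhere; the coefficients of `X` in a product
of such weights count subsets of the marked points. -/
def markWeight (s : ι → ℤ) (a : ℤ) : R[X] := if a ∈ Finset.univ.image s then 1 + X else 1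

theorem coeff_prod_markWeight {c : Fin N → ℤ} (hc : Function.Injective c)
    (hs : Function.Injective s) :
    (∏ j, markWeight R s (c j)).coeff (Fintype.card ι) =
      if Finset.univ.image s ⊆ Finset.univ.image c then 1 else 0 := by
  set A := Finset.univ.image s
  set B := Finset.univ.image c with hB
  have hcardA : A.card = Fintype.card ι := Finset.card_image_of_injective _ hs
  have hprod : ∏ j, markWeight R s (c j) = (1 + X) ^ (B ∩ A).card := by
    rw [← Finset.prod_const, ← Finset.prod_ite_mem, hB, Finset.prod_image hc.injOn]
    rfl
  rw [hprod, coeff_one_add_X_pow, ← hcardA]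
  split_ifs with h
  · rw [Finset.inter_eq_right.2 h, Nat.choose_self, Nat.cast_one]
  · have hlt : (B ∩ A).card < A.card := Finset.card_lt_card
      ⟨Finset.inter_subset_right, fun h' => h (h'.trans Finset.inter_subset_left)⟩
    rw [Nat.choose_eq_zero_of_lt hlt, Nat.cast_zero]

theorem sum_markWeight_mul (hs : Function.Injective s) {I : Finset ℤ} (hsI : ∀ i, s i ∈ I)
    (F : ℤ → R) :
    ∑ a ∈ I, markWeight R s a * C (F a) = C (∑ a ∈ I, F a) + X * ∑ i, C (F (s i)) := by
  calc ∑ a ∈ I, markWeight R s a * C (F a)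
      = ∑ a ∈ I, C (F a) + ∑ a ∈ I, if a ∈ Finset.univ.image s then X * C (F a) else 0 := by
        rw [← Finset.sum_add_distrib]
        refine Finset.sum_congr rfl fun a _ => ?_
        rw [markWeight]
        split_ifs <;> ring
    _ = C (∑ a ∈ I, F a) + X * ∑ i, C (F (s i)) := by
        rw [Finset.sum_ite_mem,
          Finset.inter_eq_right.2 (Finset.image_subset_iff.2 fun i _ => hsI i),
          Finset.sum_image hs.injOn, map_sum, Finset.mul_sum]

theorem coeff_det_sum_markWeight [DecidableEq ι] {I : Finset ℤ} {φ ψ : Fin N → ℤ → R}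
    (hbi : ∀ i j, ∑ a ∈ I, φ i a * ψ j a = if i = j then 1 else 0)
    (hs : Function.Injective s) (hsI : ∀ i, s i ∈ I) :
    (Matrix.of fun i j : Fin N =>
        ∑ a ∈ I, markWeight R s a * C (φ i a) * C (ψ j a)).det.coeff (Fintype.card ι) =
      (Matrix.of fun i j => ∑ l, φ l (s i) * ψ l (s j)).det := by
  let P : Matrix (Fin N) ι R[X] := Matrix.of fun l i => C (φ l (s i))
  let Q : Matrix ι (Fin N) R[X] := Matrix.of fun i l => C (ψ l (s i))
  let K : Matrix ι ι R := Matrix.of fun i j => ∑ l, φ l (s i) * ψ l (s j)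
  have hgram : (Matrix.of fun i j : Fin N =>
      ∑ a ∈ I, markWeight R s a * C (φ i a) * C (ψ j a)) = 1 + P * ((X : R[X]) • Q) := by
    ext1 i j
    simp only [Matrix.of_apply, Matrix.add_apply, mul_assoc, ← C_mul]
    rw [sum_markWeight_mul hs hsI fun a => φ i a * ψ j a, hbi]
    simp only [P, Q, Matrix.mul_apply, Matrix.one_apply, apply_ite C, C_1, C_0, Finset.mul_sum,
      Matrix.of_apply, Matrix.smul_apply, smul_eq_mul, C_mul, mul_left_comm X]
  have hkernel :
      1 + (X : R[X]) • Q * P = (X : R[X]) • K.transpose.map C + (1 : Matrix ι ι R).map C := by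
    ext1 i j
    simp only [P, Q, K, Matrix.add_apply, Matrix.mul_apply, Matrix.one_apply, apply_ite C, C_1, C_0,
      Matrix.of_apply, Matrix.smul_apply, Matrix.map_apply, Matrix.transpose_apply, smul_eq_mul,
      C_mul, map_sum, Finset.mul_sum, mul_assoc, mul_comm (C (ψ _ _)), add_comm]
  rw [hgram, Matrix.det_one_add_mul_comm, hkernel, coeff_det_X_add_C_card, Matrix.det_transpose]

/-- Marking the points of `s`, both sides become the top coefficient of the generating function
`∑ det[φ] det[ψ] (1 + X) ^ #{occupied points of s}`. -/
theorem sum_det_mul_det_eq_det_kernel [DecidableEq ι] {φ ψ : Fin N → ℤ → R}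
    (hbi : ∀ i j, ∑ a ∈ Finset.Icc (1 - (N : ℤ)) k, φ i a * ψ j a = if i = j then 1 else 0)
    (hs : Function.Injective s) (hsI : ∀ i, s i ∈ Finset.Icc (1 - (N : ℤ)) k) :
    ∑ lam ∈ boxDiagrams N k with
        Finset.univ.image s ⊆ Finset.univ.image fun j : Fin N => coord lam j,
      (Matrix.of fun i j : Fin N => φ i (coord lam j)).det *
        (Matrix.of fun i j : Fin N => ψ i (coord lam j)).det =
      (Matrix.of fun i j => ∑ l, φ l (s i) * ψ l (s j)).det := by
  rw [← coeff_det_sum_markWeight hbi hs hsI,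
    det_sum_mul_eq_sum_boxDiagrams N k (fun i a => markWeight R s a * C (φ i a))
      (fun j a => C (ψ j a)), finsetSum_coeff, Finset.sum_filter]
  refine Finset.sum_congr rfl fun lam _ => ?_
  have hψ : (Matrix.of fun i j : Fin N => C (ψ i (coord lam j))).det =
      C (Matrix.of fun i j : Fin N => ψ i (coord lam j)).det := (C.map_det _).symm
  have hφ : (Matrix.of fun i j : Fin N => C (φ i (coord lam j))).det =
      C (Matrix.of fun i j : Fin N => φ i (coord lam j)).det := (C.map_det _).symm
  have hmark := Matrix.det_mul_row (fun j : Fin N => markWeight R s (coord lam j))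
    (Matrix.of fun i j => C (φ i (coord lam j)))
  simp only [Matrix.of_apply] at hmark
  rw [hmark, hφ, hψ, mul_assoc, ← C_mul, coeff_mul_C,
    coeff_prod_markWeight (coord_fin_strictAnti lam N).injective hs, ite_mul, one_mul, zero_mul]

end Ensemble

theorem mem_range_coord_of_le {n k : ℕ} {lam : YoungDiagram} (hl : lam ∈ boxDiagrams n k) {c : ℤ}
    (hc : c ≤ -n) : c ∈ Set.range (coord lam) :=
  ⟨(-c).toNat, by rw [coord_eq_neg hl (by lia)]; lia⟩

theorem notMem_range_coord_of_gt {n k : ℕ} {lam : YoungDiagram} (hl : lam ∈ boxDiagrams n k)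
    {c : ℤ} (hc : k < c) : c ∉ Set.range (coord lam) := by
  rintro ⟨i, rfl⟩
  have hrow := rowLen_le hl i
  rw [coord] at hc
  lia

theorem mem_range_coord_iff {n k : ℕ} {lam : YoungDiagram} (hl : lam ∈ boxDiagrams n k) {c : ℤ}
    (hc : 1 - n ≤ c) :
    c ∈ Set.range (coord lam) ↔ c ∈ Finset.univ.image fun j : Fin n => coord lam j := by
  simp only [Finset.mem_image, Finset.mem_univ, true_and, Set.mem_range]
  refine ⟨?_, fun ⟨j, hj⟩ => ⟨j, hj⟩⟩
  rintro ⟨i, rfl⟩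
  have hi : i < n := not_le.1 fun h => by
    rw [coord_eq_neg hl h] at hc
    lia
  exact ⟨⟨i, hi⟩, rfl⟩

/-! ### Determinantal formulas for the kernel -/

section Determinantal

variable {R : Type*} [CommRing R] {n k : ℕ} {x : Fin n → R} {y : Fin k → R} {u : ℤ → R}

/-- The weight of `lam` in the biorthogonal ensemble of the functions `partner x u l` and
`M ↦ e_{M + l}(y)`. -/
def ensembleWeight (x : Fin n → R) (y : Fin k → R) (u : ℤ → R) (lam : YoungDiagram) : R :=
  (Matrix.of fun l i : Fin n => partner x u l (coord lam i)).det *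
    (Matrix.of fun l i : Fin n => esymm y (coord lam i + l)).det

theorem IsSymbolCoeff.ensembleWeight_eq_det_kernel (hu : IsSymbolCoeff x y u) {lam : YoungDiagram}
    (hl : lam ∈ boxDiagrams n k) :
    ensembleWeight x y u lam =
      (Matrix.of fun i j : Fin n => kernel x y u (coord lam i) (coord lam j)).det := by
  rw [ensembleWeight, ← Matrix.det_transpose (Matrix.of fun l i : Fin n => partner x u l _),
    ← Matrix.det_mul]
  congr 1
  ext1 i j
  rw [Matrix.of_apply, hu.kernel_eq_sum (Finset.mem_Icc.1 (coord_mem_Icc hl i)).1]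
  rfl

variable {ι : Type*} [Fintype ι] [DecidableEq ι] {s : ι → ℤ}

open Classical in
/-- The points above `k` are never occupied. -/
theorem IsSymbolCoeff.sum_ensembleWeight_of_ge (hu : IsSymbolCoeff x y u)
    (hs : Function.Injective s) (hsn : ∀ i, 1 - n ≤ s i) :
    ∑ lam ∈ boxDiagrams n k with ∀ i, s i ∈ Set.range (coord lam), ensembleWeight x y u lam =
      (Matrix.of fun i j => kernel x y u (s i) (s j)).det := by
  by_cases hk : ∀ i, s i ≤ k
  · simp only [fun i => hu.kernel_eq_sum (hsn i)]
    rw [← sum_det_mul_det_eq_det_kernel (k := k) (φ := fun l a => partner x u l a)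
      (ψ := fun l a => esymm y (a + l)) hu.biorthogonal hs fun i => Finset.mem_Icc.2 ⟨hsn i, hk i⟩]
    refine Finset.sum_congr (Finset.filter_congr fun lam hl => ?_) fun _ _ => rfl
    simp only [mem_range_coord_iff hl (hsn _), Finset.image_subset_iff, Finset.mem_univ,
      true_imp_iff]
  · push Not at hk
    obtain ⟨j, hj⟩ := hk
    rw [Matrix.det_eq_zero_of_column_eq_zero j fun i => kernel_of_gt x y u (s i) hj]
    refine Finset.sum_eq_zero fun lam hl => ?_
    obtain ⟨hl, h⟩ := Finset.mem_filter.1 hl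
    exact absurd (h j) (notMem_range_coord_of_gt hl hj)

open Classical in
/-- The points below `1 - n` are always occupied. -/
theorem IsSymbolCoeff.sum_ensembleWeight (hu : IsSymbolCoeff x y u) (hs : Function.Injective s) :
    ∑ lam ∈ boxDiagrams n k with ∀ i, s i ∈ Set.range (coord lam), ensembleWeight x y u lam =
      (Matrix.of fun i j => kernel x y u (s i) (s j)).det := by
  set K := Matrix.of fun i j => kernel x y u (s i) (s j) with hK
  have hfrozen (i j : ι) (hj : s j ≤ -n) : K i j = if i = j then 1 else 0 := by
    simp only [hK, Matrix.of_apply, hu.kernel_of_le (s i) hj, hs.eq_iff]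
  have hblock : (K.toSquareBlockProp fun i => s i ≤ -n) = 1 := by
    ext i j
    simp only [Matrix.toSquareBlockProp_def, Matrix.of_apply, hfrozen i j j.2, Matrix.one_apply,
      Subtype.ext_iff]
  rw [Matrix.twoBlockTriangular_det K (fun i => s i ≤ -n) fun i hi j hj => by
      rw [hfrozen i j hj, if_neg (ne_of_apply_ne (s · ≤ -n) (by simp [hi, hj]))],
    hblock, Matrix.det_one, one_mul]
  refine Eq.trans (Finset.sum_congr (Finset.filter_congr fun lam hl => ?_) fun _ _ => rfl)
    (hu.sum_ensembleWeight_of_ge (s := fun i : {i // ¬s i ≤ -n} => s i)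
      (hs.comp Subtype.val_injective) fun i => by have := i.2; lia)
  refine ⟨fun h i => h i, fun h i => ?_⟩
  by_cases hi : s i ≤ -n
  · exact mem_range_coord_of_le hl hi
  · exact h ⟨i, hi⟩

end Determinantal

/-! ### The dual Cauchy measure as an ensemble weight -/

section Measure

variable {n k : ℕ} {x : Fin n → ℝ} {y : Fin k → ℝ} {u : ℤ → ℂ}

theorem IsSymbolCoeff.dualCauchyMeasure_eq_ensembleWeight
    (hu : IsSymbolCoeff (fun i => (x i : ℂ)) (fun j => (y j : ℂ)) u) {lam : YoungDiagram}
    (hl : lam ∈ boxDiagrams n k) :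
    (dualCauchyMeasure x y lam : ℂ) =
      ensembleWeight (fun i => (x i : ℂ)) (fun j => (y j : ℂ)) u lam := by
  have hschur : (schur lam x : ℂ) =
      (Matrix.of fun i j : Fin n => hsymm (fun i => (x i : ℂ)) (coord lam i + j)).det := by
    rw [schur_eq_det_hsymm x hl, ← Complex.ofRealHom_eq_coe, RingHom.map_det]
    simp only [← Complex.ofRealHom_eq_coe, ← map_hsymm]
    rfl
  have hschur' : (schur lam.transpose y : ℂ) =
      (Matrix.of fun i j : Fin n => esymm (fun j => (y j : ℂ)) (coord lam i + j)).det := by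
    rw [schur_transpose_eq_det_esymm y hl, ← Complex.ofRealHom_eq_coe, RingHom.map_det]
    simp only [← Complex.ofRealHom_eq_coe, ← map_esymm]
    rfl
  have hpartner : (Matrix.of fun l i : Fin n =>
      partner (fun i => (x i : ℂ)) u l (coord lam i)).det = (schur lam x : ℂ) *
        (Matrix.of fun i t : Fin n => u ((t : ℤ) - i)).det := by
    rw [hschur,
      ← det_eq_det_hsymm_mul hu.forward fun i => (Finset.mem_Icc.1 (coord_mem_Icc hl i)).1,
      ← det_partner, ← Matrix.det_transpose]
    rfl
  have hesymm : (Matrix.of fun l i : Fin n =>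
      esymm (fun j => (y j : ℂ)) (coord lam i + l)).det = (schur lam.transpose y : ℂ) := by
    rw [hschur', ← Matrix.det_transpose]
    rfl
  rw [ensembleWeight, hpartner, hesymm, dualCauchyMeasure]
  push_cast
  rw [div_eq_iff (left_ne_zero_of_mul_eq_one hu.prod_mul_det)]
  linear_combination -(schur lam x : ℂ) * schur lam.transpose y * hu.prod_mul_det

theorem mayaCoord_eq (lam : YoungDiagram) (i : ℕ) :
    mayaCoord lam i = (coord lam i : ℝ) - 1 / 2 := by
  rw [mayaCoord, coord]
  push_cast
  ring

theorem sub_half_mem_mayaDiagram_iff {lam : YoungDiagram} {M : ℤ} :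
    (M : ℝ) - 1 / 2 ∈ mayaDiagram lam ↔ M ∈ Set.range (coord lam) := by
  simp only [mayaDiagram, Set.mem_range, mayaCoord_eq, sub_left_inj, Int.cast_inj]

theorem exists_eq_sub_half {m : ℝ} (hm : m ∈ halfIntegers) : ∃ M : ℤ, m = M - 1 / 2 := by
  obtain ⟨a, rfl⟩ := hm
  exact ⟨a + 1, by push_cast; ring⟩

theorem IsSymbolCoeff.dualCauchyMeasure_eq_det_kernel
    (hu : IsSymbolCoeff (fun i => (x i : ℂ)) (fun j => (y j : ℂ)) u) {lam : YoungDiagram}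
    (hl : lam ∈ boxDiagrams n k) :
    (dualCauchyMeasure x y lam : ℂ) = (Matrix.of fun i j : Fin n =>
      kernel (fun i => (x i : ℂ)) (fun j => (y j : ℂ)) u (coord lam i) (coord lam j)).det :=
  (hu.dualCauchyMeasure_eq_ensembleWeight hl).trans (hu.ensembleWeight_eq_det_kernel hl)

theorem IsSymbolCoeff.correlation_eq_det_kernel
    (hu : IsSymbolCoeff (fun i => (x i : ℂ)) (fun j => (y j : ℂ)) u) {r : ℕ} {s : Fin r → ℤ}
    (hs : Function.Injective s) :
    (correlation x y (fun i => (s i : ℝ) - 1 / 2) : ℂ) = (Matrix.of fun i j : Fin r =>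
      kernel (fun i => (x i : ℂ)) (fun j => (y j : ℂ)) u (s i) (s j)).det := by
  classical
  rw [← hu.sum_ensembleWeight hs, correlation, Complex.ofReal_sum]
  simp only [sub_half_mem_mayaDiagram_iff]
  refine Finset.sum_congr (by congr!) fun lam hl => hu.dualCauchyMeasure_eq_ensembleWeight ?_
  simp only [Finset.mem_filter] at hl
  exact hl.1

end Measure

/-! ### Contour integrals -/

section Contour

variable {γ : ℝ → ℂ} {a b : ℝ} {f g F : ℂ → ℂ}

theorem intervalIntegrable_comp_mul_deriv (hab : a ≤ b)
    (hγ : ContDiffOn ℝ 1 γ (Set.Icc a b)) (hf : ContinuousOn (fun t => f (γ t)) (Set.Icc a b)) :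
    IntervalIntegrable (fun t => f (γ t) * deriv γ t) MeasureTheory.volume a b := by
  rcases hab.eq_or_lt with rfl | hlt
  · exact IntervalIntegrable.refl
  have hwithin : ContinuousOn (fun t => f (γ t) * derivWithin γ (Set.Icc a b) t) (Set.Icc a b) :=
    hf.mul (hγ.continuousOn_derivWithin (uniqueDiffOn_Icc hlt) le_rfl)
  refine (hwithin.intervalIntegrable_of_Icc hab).congr_uIoo fun t ht => ?_
  rw [Set.uIoo_of_le hab] at ht
  simp only [derivWithin_of_mem_nhds (Icc_mem_nhds ht.1 ht.2)]

theorem integral_comp_mul_deriv_eq_sub (hab : a ≤ b) (hγ : ContDiffOn ℝ 1 γ (Set.Icc a b))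
    (hf : ContinuousOn (fun t => f (γ t)) (Set.Icc a b))
    (hF : ∀ t ∈ Set.Icc a b, HasDerivAt F (f (γ t)) (γ t)) :
    ∫ t in a..b, f (γ t) * deriv γ t = F (γ b) - F (γ a) := by
  refine intervalIntegral.integral_eq_sub_of_hasDerivAt_of_le (f := fun t => F (γ t)) hab
    (fun t ht => (hF t ht).continuousAt.comp_continuousWithinAt (hγ.continuousOn t ht))
    (fun t ht => ?_) (intervalIntegrable_comp_mul_deriv hab hγ hf)
  have hd : DifferentiableAt ℝ γ t :=
    (hγ.differentiableOn one_ne_zero).differentiableAt (Icc_mem_nhds ht.1 ht.2)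
  exact (hF t (Set.Ioo_subset_Icc_self ht)).comp_of_eq t hd.hasDerivAt rfl

theorem IsContour.exists_partition (hγ : IsContour γ) :
    ∃ (N : ℕ) (t : ℕ → ℝ), t 0 = 0 ∧ t N = 1 ∧ ∀ i < N, t i ≤ t (i + 1) ∧
      ContDiffOn ℝ 1 γ (Set.Icc (t i) (t (i + 1))) ∧
        ∀ s ∈ Set.Icc (t i) (t (i + 1)), γ s ∈ trace γ := by
  obtain ⟨-, N, t, ht, h0, h1, hC⟩ := hγ
  refine ⟨N, t, h0, h1, fun i hi => ⟨ht i.le_succ, hC i hi, fun s hs => ⟨s, ?_, rfl⟩⟩⟩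
  exact ⟨h0 ▸ (ht i.zero_le).trans hs.1, h1 ▸ hs.2.trans (ht hi)⟩

theorem IsContour.intervalIntegrable (hγ : IsContour γ) (hf : ContinuousOn f (trace γ)) :
    IntervalIntegrable (fun t => f (γ t) * deriv γ t) MeasureTheory.volume 0 1 := by
  obtain ⟨N, t, h0, h1, hpiece⟩ := hγ.exists_partition
  rw [← h0, ← h1]
  refine IntervalIntegrable.trans_iterate fun i hi => ?_
  obtain ⟨hle, hC, hmem⟩ := hpiece i hi
  exact intervalIntegrable_comp_mul_deriv hle hC (hf.comp hC.continuousOn hmem)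

theorem IsContour.integral_eq_zero (hγ : IsContour γ) (hf : ContinuousOn f (trace γ))
    (hF : ∀ z ∈ trace γ, HasDerivAt F (f z) z) : contourIntegral γ f = 0 := by
  obtain ⟨N, t, h0, h1, hpiece⟩ := hγ.exists_partition
  have hint (i : ℕ) (hi : i < N) : IntervalIntegrable (fun t => f (γ t) * deriv γ t)
      MeasureTheory.volume (t i) (t (i + 1)) := by
    obtain ⟨hle, hC, hmem⟩ := hpiece i hi
    exact intervalIntegrable_comp_mul_deriv hle hC (hf.comp hC.continuousOn hmem)
  have hFTC (i : ℕ) (hi : i ∈ Finset.range N) : ∫ s in t i..t (i + 1), f (γ s) * deriv γ s =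
      F (γ (t (i + 1))) - F (γ (t i)) := by
    obtain ⟨hle, hC, hmem⟩ := hpiece i (Finset.mem_range.1 hi)
    exact integral_comp_mul_deriv_eq_sub hle hC (hf.comp hC.continuousOn hmem)
      fun s hs => hF _ (hmem s hs)
  rw [contourIntegral, ← h0, ← h1, ← intervalIntegral.sum_integral_adjacent_intervals hint,
    Finset.sum_congr rfl hFTC, Finset.sum_range_sub (fun i => F (γ (t i))), h0, h1, hγ.1, sub_self]

theorem contourIntegral_congr (h : ∀ z ∈ trace γ, f z = g z) :
    contourIntegral γ f = contourIntegral γ g := by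
  refine intervalIntegral.integral_congr fun t ht => ?_
  rw [Set.uIcc_of_le zero_le_one] at ht
  rw [h _ (Set.mem_image_of_mem γ ht)]

theorem contourIntegral_const_mul (γ : ℝ → ℂ) (c : ℂ) (f : ℂ → ℂ) :
    contourIntegral γ (fun z => c * f z) = c * contourIntegral γ f := by
  simp only [contourIntegral, mul_assoc, intervalIntegral.integral_const_mul]

theorem IsContour.integral_add (hγ : IsContour γ) (hf : ContinuousOn f (trace γ))
    (hg : ContinuousOn g (trace γ)) :
    contourIntegral γ (fun z => f z + g z) = contourIntegral γ f + contourIntegral γ g := by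
  simp only [contourIntegral, add_mul]
  exact intervalIntegral.integral_add (hγ.intervalIntegrable hf) (hγ.intervalIntegrable hg)

theorem IsContour.integral_sub (hγ : IsContour γ) (hf : ContinuousOn f (trace γ))
    (hg : ContinuousOn g (trace γ)) :
    contourIntegral γ (fun z => f z - g z) = contourIntegral γ f - contourIntegral γ g := by
  simp only [contourIntegral, sub_mul]
  exact intervalIntegral.integral_sub (hγ.intervalIntegrable hf) (hγ.intervalIntegrable hg)

theorem IsContour.integral_sum {ι : Type*} (hγ : IsContour γ) (s : Finset ι) {f : ι → ℂ → ℂ}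
    (hf : ∀ i ∈ s, ContinuousOn (f i) (trace γ)) :
    contourIntegral γ (fun z => ∑ i ∈ s, f i z) = ∑ i ∈ s, contourIntegral γ (f i) := by
  simp only [contourIntegral, Finset.sum_mul]
  exact intervalIntegral.integral_finsetSum fun i hi => hγ.intervalIntegrable (hf i hi)

theorem IsContour.integral_zpow (hγ : IsContour γ) {p : ℂ} {e : ℤ} (hp : p ∉ trace γ ∨ 0 ≤ e)
    (he : e ≠ -1) : contourIntegral γ (fun z => (z - p) ^ e) = 0 := by
  have hne (z : ℂ) (hz : z ∈ trace γ) : z - p ≠ 0 ∨ 0 ≤ e :=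
    hp.imp_left fun hp h0 => hp (sub_eq_zero.1 h0 ▸ hz)
  have he' : ((e + 1 : ℤ) : ℂ) ≠ 0 := by exact_mod_cast fun h : e + 1 = 0 => he (by lia)
  refine hγ.integral_eq_zero (F := fun z => (z - p) ^ (e + 1) / ((e + 1 : ℤ) : ℂ))
    ((continuousOn_id.sub continuousOn_const).zpow₀ e hne) fun z hz => ?_
  have hderiv := ((hasDerivAt_zpow (e + 1) (z - p) ((hne z hz).imp_right fun h => by lia)).comp z
    ((hasDerivAt_id z).sub_const p)).div_const ((e + 1 : ℤ) : ℂ)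
  rwa [add_sub_cancel_right, mul_one, mul_div_cancel_left₀ _ he'] at hderiv

theorem continuousOn_zpow_of_notMem {S : Set ℂ} (h0 : (0 : ℂ) ∉ S) (e : ℤ) :
    ContinuousOn (fun z : ℂ => z ^ e) S :=
  continuousOn_id.zpow₀ e fun _ hz => Or.inl (ne_of_mem_of_not_mem hz h0)

end Contour

/-! ### Rational functions with prescribed poles -/

section PoleProd

variable {γ : ℝ → ℂ} {c p : ℂ} {P : Multiset ℂ}

/-- The rational function `∏ 1 / (z - p)` with poles in a multiset `P`. -/
def poleProd (P : Multiset ℂ) (z : ℂ) : ℂ := (P.map fun p => (z - p)⁻¹).prod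

theorem poleProd_zero (z : ℂ) : poleProd 0 z = 1 := by simp [poleProd]

theorem poleProd_cons (p : ℂ) (P : Multiset ℂ) (z : ℂ) :
    poleProd (p ::ₘ P) z = (z - p)⁻¹ * poleProd P z := by simp [poleProd]

theorem poleProd_add (P Q : Multiset ℂ) (z : ℂ) :
    poleProd (P + Q) z = poleProd P z * poleProd Q z := by simp [poleProd]

theorem poleProd_replicate (m : ℕ) (p z : ℂ) :
    poleProd (Multiset.replicate m p) z = (z - p) ^ (-(m : ℤ)) := by
  simp [poleProd]

theorem continuousOn_poleProd {S : Set ℂ} (hP : ∀ p ∈ P, p ∉ S) : ContinuousOn (poleProd P) S := by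
  refine continuousOn_multiset_prod P fun p hp => ?_
  exact (continuousOn_id.sub continuousOn_const).inv₀ fun z hz =>
    sub_ne_zero.2 (ne_of_mem_of_not_mem hz (hP p hp))

theorem IsContour.integral_poleProd_cons_cons (hγ : IsContour γ) {q : ℂ}
    (hP : ∀ a ∈ p ::ₘ q ::ₘ P, a ∉ trace γ) :
    (p - q) * contourIntegral γ (poleProd (p ::ₘ q ::ₘ P)) =
      contourIntegral γ (poleProd (p ::ₘ P)) - contourIntegral γ (poleProd (q ::ₘ P)) := by
  rw [← contourIntegral_const_mul, ← hγ.integral_sub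
    (continuousOn_poleProd fun a ha => hP a (by simp_all; tauto))
    (continuousOn_poleProd fun a ha => hP a (Multiset.mem_cons_of_mem ha))]
  refine contourIntegral_congr fun z hz => ?_
  have hp : z - p ≠ 0 := sub_ne_zero.2 (ne_of_mem_of_not_mem hz (hP p (by simp)))
  have hq : z - q ≠ 0 := sub_ne_zero.2 (ne_of_mem_of_not_mem hz (hP q (by simp)))
  simp only [poleProd_cons]
  field_simp
  ring

theorem IsContour.integral_poleProd_replicate (hγ : IsContour γ) {m : ℕ} (hp : p ∉ trace γ ∨ m = 0)
    (hm : m ≠ 1) : contourIntegral γ (poleProd (Multiset.replicate m p)) = 0 := by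
  rw [show poleProd (Multiset.replicate m p) = fun z => (z - p) ^ (-(m : ℤ)) from
    funext (poleProd_replicate m p)]
  exact hγ.integral_zpow (hp.imp_right (by lia)) (by lia)

theorem contourIntegral_poleProd_singleton (γ : ℝ → ℂ) (p : ℂ) :
    contourIntegral γ (poleProd {p}) = 2 * Real.pi * Complex.I * windingNumber γ p := by
  rw [windingNumber, mul_inv_cancel_left₀ Complex.two_pi_I_ne_zero]
  exact contourIntegral_congr fun z _ => by simp [poleProd]

theorem IsContour.integral_poleProd (hγ : IsContour γ)
    (hP : ∀ p ∈ P, p ∉ trace γ ∧ windingNumber γ p = c) :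
    contourIntegral γ (poleProd P) = if P.card = 1 then 2 * Real.pi * Complex.I * c else 0 := by
  induction hn : P.card using Nat.strong_induction_on generalizing P with
  | _ m ih =>
    subst hn
    by_cases hrep : ∃ p, P = Multiset.replicate P.card p
    · obtain ⟨p, hp⟩ := hrep
      split_ifs with hcard
      · rw [hcard, Multiset.replicate_one] at hp
        rw [hp, contourIntegral_poleProd_singleton, (hP p (by simp [hp])).2]
      · rw [hp]
        refine hγ.integral_poleProd_replicate (or_iff_not_imp_right.2 fun h0 => ?_) hcard
        obtain ⟨b, hb⟩ := Multiset.card_pos_iff_exists_mem.1 (Nat.pos_of_ne_zero h0)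
        exact Multiset.eq_replicate_card.1 hp b hb ▸ (hP b hb).1
    · simp only [Multiset.eq_replicate_card] at hrep
      push Not at hrep
      obtain ⟨p, hp, -⟩ := hrep 0
      obtain ⟨q, hq, hqp⟩ := hrep p
      obtain ⟨P, rfl⟩ := Multiset.exists_cons_of_mem hp
      obtain ⟨P, rfl⟩ := Multiset.exists_cons_of_mem ((Multiset.mem_cons.1 hq).resolve_left hqp)
      have hsplit := hγ.integral_poleProd_cons_cons fun a ha => (hP a ha).1
      rw [ih (p ::ₘ P).card (by simp) (fun a ha => hP a (by simp_all; tauto)) rfl,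
        ih (q ::ₘ P).card (by simp) (fun a ha => hP a (Multiset.mem_cons_of_mem ha)) rfl,
        Multiset.card_cons, Multiset.card_cons, sub_self] at hsplit
      rw [(mul_eq_zero.1 hsplit).resolve_left (sub_ne_zero.2 hqp.symm), if_neg (by simp)]

theorem IsContour.integral_pow_succ_mul_poleProd_cons (hγ : IsContour γ)
    (hP : ∀ a ∈ p ::ₘ P, a ∉ trace γ) (j : ℕ) :
    contourIntegral γ (fun z => z ^ (j + 1) * poleProd (p ::ₘ P) z) =
      contourIntegral γ (fun z => z ^ j * poleProd P z) +
        p * contourIntegral γ (fun z => z ^ j * poleProd (p ::ₘ P) z) := by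
  have hcont {Q : Multiset ℂ} (hQ : ∀ a ∈ Q, a ∉ trace γ) :
      ContinuousOn (fun z => z ^ j * poleProd Q z) (trace γ) :=
    (continuousOn_pow j).mul (continuousOn_poleProd hQ)
  rw [← contourIntegral_const_mul, ← hγ.integral_add (g := fun z => p * (z ^ j * _))
    (hcont fun a ha => hP a (Multiset.mem_cons_of_mem ha)) (continuousOn_const.mul (hcont hP))]
  refine contourIntegral_congr fun z hz => ?_
  have hp : z - p ≠ 0 := sub_ne_zero.2 (ne_of_mem_of_not_mem hz (hP p (by simp)))
  simp only [poleProd_cons]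
  field_simp
  ring

/-- If all poles have winding number `c`, the integral is `2πi c` times the sum of all residues,
which vanishes when the integrand decays like `z⁻²`. -/
theorem IsContour.integral_pow_mul_poleProd_eq_zero (hγ : IsContour γ) {j : ℕ}
    (hP : ∀ p ∈ P, p ∉ trace γ ∧ windingNumber γ p = c) (hj : c = 0 ∨ j + 2 ≤ P.card) :
    contourIntegral γ (fun z => z ^ j * poleProd P z) = 0 := by
  induction j generalizing P with
  | zero =>
    simp only [pow_zero, one_mul]
    rw [hγ.integral_poleProd hP]
    rcases hj with rfl | hj
    · simp
    · exact if_neg (by lia)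
  | succ j ih =>
    induction P using Multiset.induction_on with
    | empty =>
      have h := hγ.integral_zpow (p := 0) (e := (j + 1 : ℕ)) (Or.inr (by lia)) (by lia)
      simpa [poleProd_zero, ← zpow_natCast] using h
    | cons p P _ =>
      rw [Multiset.card_cons] at hj
      rw [hγ.integral_pow_succ_mul_poleProd_cons fun a ha => (hP a ha).1,
        ih hP (hj.imp_right fun h => by rw [Multiset.card_cons]; lia),
        ih (fun a ha => hP a (Multiset.mem_cons_of_mem ha)) (hj.imp_right fun h => by lia),
        mul_zero, add_zero]

end PoleProd

/-! ### Laurent coefficients along a contour -/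

section ContourCoeff

variable {γ : ℝ → ℂ} {f g : ℂ → ℂ}

/-- The Laurent coefficient `(2πi)⁻¹ ∮ f(z) z^{-a-1} dz` of `f` along the contour `γ`. -/
def contourCoeff (γ : ℝ → ℂ) (f : ℂ → ℂ) (a : ℤ) : ℂ :=
  (2 * Real.pi * Complex.I)⁻¹ * contourIntegral γ fun z => f z * z ^ (-a - 1)

theorem contourCoeff_congr (h : ∀ z ∈ trace γ, f z = g z) : contourCoeff γ f = contourCoeff γ g :=
  funext fun a => by rw [contourCoeff, contourIntegral_congr fun z hz => by rw [h z hz]]; rfl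

theorem IsContour.contourCoeff_one (hγ : IsContour γ) (h0 : Encircles γ 0) :
    contourCoeff γ 1 = Pi.single 0 1 := by
  funext a
  simp only [contourCoeff, Pi.one_apply, one_mul, Pi.single_apply]
  split_ifs with ha
  · simpa [windingNumber, ha] using h0.2
  · have h := hγ.integral_zpow (Or.inl h0.1) (show -a - 1 ≠ -1 by lia)
    simp only [sub_zero] at h
    rw [h, mul_zero]

theorem IsContour.contourCoeff_sum_zpow_mul {ι : Type*} (hγ : IsContour γ)
    (h0 : (0 : ℂ) ∉ trace γ) (hf : ContinuousOn f (trace γ)) (s : Finset ι) (c : ι → ℂ)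
    (e : ι → ℤ) (a : ℤ) :
    contourCoeff γ (fun z => (∑ i ∈ s, c i * z ^ e i) * f z) a =
      ∑ i ∈ s, c i * contourCoeff γ f (a - e i) := by
  have hexpand (z : ℂ) (hz : z ∈ trace γ) : (∑ i ∈ s, c i * z ^ e i) * f z * z ^ (-a - 1) =
      ∑ i ∈ s, c i * (f z * z ^ (-(a - e i) - 1)) := by
    rw [Finset.sum_mul, Finset.sum_mul]
    refine Finset.sum_congr rfl fun i _ => ?_
    rw [show -(a - e i) - 1 = e i + (-a - 1) by ring, zpow_add₀ (ne_of_mem_of_not_mem hz h0)]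
    ring
  rw [contourCoeff, contourIntegral_congr hexpand, hγ.integral_sum s
    (f := fun i z => c i * (f z * z ^ (-(a - e i) - 1))) fun i _ =>
      continuousOn_const.mul (hf.mul (continuousOn_zpow_of_notMem h0 _)), Finset.mul_sum]
  refine Finset.sum_congr rfl fun i _ => ?_
  rw [contourIntegral_const_mul, contourCoeff]
  ring

theorem IsContour.shiftAction_contourCoeff (hγ : IsContour γ) (h0 : (0 : ℂ) ∉ trace γ)
    (hf : ContinuousOn f (trace γ)) {m : ℕ} (y : Fin m → ℂ) (c : ℤ) :
    shiftAction ℂ (linearProd y c) (contourCoeff γ f) =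
      contourCoeff γ fun z => (∏ j, (1 + y j * z ^ (-c))) * f z := by
  funext a
  have hpow (z : ℂ) (p : ℕ) : (z ^ (-c)) ^ p = z ^ (-(p * c)) := by
    rw [← zpow_natCast, ← zpow_mul]
    ring_nf
  simp only [shiftAction_linearProd, prod_one_add_mul, hpow]
  rw [hγ.contourCoeff_sum_zpow_mul h0 hf]
  simp only [sub_neg_eq_add]

end ContourCoeff

/-! ### The generating function of the complete symmetric polynomials -/

section HsymmGen

variable {n : ℕ} {x : Fin n → ℂ} {γ : ℝ → ℂ}

/-- The rational function `H(z) = ∏ 1 / (1 - x_i z)`, the generating function of the complete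
homogeneous symmetric polynomials. In terms of it the symbol of the kernel is
`H_x(z) H_{-y}(1/z)`. -/
def hsymmGen (x : Fin n → ℂ) (z : ℂ) : ℂ := ∏ i, 1 / (1 - x i * z)

theorem hsymmGen_inv (x : Fin n → ℂ) (z : ℂ) : (hsymmGen x z)⁻¹ = ∏ i, (1 + (-x) i * z) := by
  simp [hsymmGen, sub_eq_add_neg]

theorem hsymmGen_ne_zero {z : ℂ} (hz : ∀ i, x i * z ≠ 1) : hsymmGen x z ≠ 0 :=
  Finset.prod_ne_zero_iff.2 fun i _ => one_div_ne_zero (sub_ne_zero.2 (hz i).symm)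

theorem continuousOn_hsymmGen {S : Set ℂ} (hS : ∀ z ∈ S, ∀ i, x i * z ≠ 1) :
    ContinuousOn (hsymmGen x) S :=
  continuousOn_finsetProd _ fun i _ => continuousOn_const.div
    (continuousOn_const.sub (continuousOn_const.mul continuousOn_id)) fun z hz =>
      sub_ne_zero.2 (hS z hz i).symm

theorem mul_ne_one_of_inv_notMem {S : Set ℂ} (hx : ∀ i, x i ≠ 0 → (x i)⁻¹ ∉ S) {z : ℂ}
    (hz : z ∈ S) (i : Fin n) : x i * z ≠ 1 := fun h =>
  hx i (left_ne_zero_of_mul_eq_one h) (eq_inv_of_mul_eq_one_right h ▸ hz)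

theorem exists_hsymmGen_eq_mul_poleProd (x : Fin n → ℂ) :
    ∃ (c : ℂ) (P : Multiset ℂ), (∀ p ∈ P, ∃ i, x i ≠ 0 ∧ p = (x i)⁻¹) ∧
      ∀ z, hsymmGen x z = c * poleProd P z := by
  refine ⟨∏ i with x i ≠ 0, -(x i)⁻¹, {i | x i ≠ 0}.toFinset.val.map fun i => (x i)⁻¹,
    fun p hp => ?_, fun z => ?_⟩
  · obtain ⟨i, hi, rfl⟩ := Multiset.mem_map.1 hp
    exact ⟨i, by simpa using hi, rfl⟩
  · have hpole : poleProd ({i | x i ≠ 0}.toFinset.val.map fun i => (x i)⁻¹) z =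
        ∏ i with x i ≠ 0, (z - (x i)⁻¹)⁻¹ := by
      rw [poleProd, Multiset.map_map, Set.toFinset_ofPred]
      rfl
    rw [hpole, ← Finset.prod_mul_distrib, hsymmGen,
      ← Finset.prod_filter_of_ne (p := fun i => x i ≠ 0) (by simp_all)]
    refine Finset.prod_congr rfl fun i hi => ?_
    have hx : x i ≠ 0 := (Finset.mem_filter.1 hi).2
    rw [show 1 - x i * z = -x i * (z - (x i)⁻¹) by field_simp; ring, one_div, mul_inv, inv_neg]

theorem hsymmGen_inv_eq_pow_mul_poleProd {z : ℂ} (hz : z ≠ 0) :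
    hsymmGen x z⁻¹ = z ^ n * poleProd (Finset.univ.val.map x) z := by
  have hpole : poleProd (Finset.univ.val.map x) z = ∏ i, (z - x i)⁻¹ := by
    rw [poleProd, Multiset.map_map]
    rfl
  have hpow : z ^ n = ∏ _i : Fin n, z := by simp
  rw [hpole, hpow, ← Finset.prod_mul_distrib, hsymmGen]
  refine Finset.prod_congr rfl fun i _ => ?_
  rw [show 1 - x i * z⁻¹ = (z - x i) / z by field_simp, one_div, inv_div, div_eq_mul_inv]

theorem IsContour.contourCoeff_hsymmGen (hγ : IsContour γ) (h0 : Encircles γ 0)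
    (hx : ∀ i, x i ≠ 0 → Excludes γ (x i)⁻¹) : contourCoeff γ (hsymmGen x) = hsymm x := by
  have hne (z : ℂ) (hz : z ∈ trace γ) : ∀ i, x i * z ≠ 1 :=
    mul_ne_one_of_inv_notMem (fun i hi => (hx i hi).1) hz
  refine hsymm_eq_of_shiftAction_eq ?_ fun a ha => ?_
  · rw [hγ.shiftAction_contourCoeff h0.1 (continuousOn_hsymmGen hne), ← hγ.contourCoeff_one h0]
    refine contourCoeff_congr fun z hz => ?_
    simp only [neg_neg, zpow_one]
    rw [← hsymmGen_inv, inv_mul_cancel₀ (hsymmGen_ne_zero (hne z hz)), Pi.one_apply]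
  · obtain ⟨c, P, hP, hc⟩ := exists_hsymmGen_eq_mul_poleProd x
    obtain ⟨j, hj⟩ := Int.eq_ofNat_of_zero_le (show 0 ≤ -a - 1 by lia)
    have hpole (z : ℂ) : hsymmGen x z * z ^ (-a - 1) = c * (z ^ j * poleProd P z) := by
      rw [hc, hj, zpow_natCast]
      ring
    have hexcl (p : ℂ) (hp : p ∈ P) : Excludes γ p := by
      obtain ⟨i, hi, rfl⟩ := hP p hp
      exact hx i hi
    rw [contourCoeff, contourIntegral_congr fun z _ => hpole z, contourIntegral_const_mul,
      hγ.integral_pow_mul_poleProd_eq_zero hexcl (.inl rfl), mul_zero, mul_zero]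

theorem IsContour.contourCoeff_hsymmGen_inv (hγ : IsContour γ) (h0 : Encircles γ 0)
    (hx : ∀ i, Encircles γ (x i)) {a : ℤ} (ha : 1 ≤ a) :
    contourCoeff γ (fun z => hsymmGen x z⁻¹) a = 0 := by
  obtain ⟨N, rfl⟩ := Int.eq_ofNat_of_zero_le (show 0 ≤ a by lia)
  have hpole (z : ℂ) (hz : z ∈ trace γ) : hsymmGen x z⁻¹ * z ^ (-(N : ℤ) - 1) =
      z ^ n * poleProd (Finset.univ.val.map x + Multiset.replicate (N + 1) 0) z := by
    rw [hsymmGen_inv_eq_pow_mul_poleProd (ne_of_mem_of_not_mem hz h0.1), poleProd_add,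
      poleProd_replicate, sub_zero, mul_assoc, show -((N + 1 : ℕ) : ℤ) = -N - 1 by lia]
  have hencl (p : ℂ) (hp : p ∈ Finset.univ.val.map x + Multiset.replicate (N + 1) 0) :
      Encircles γ p := by
    rcases Multiset.mem_add.1 hp with hp | hp
    · obtain ⟨i, -, rfl⟩ := Multiset.mem_map.1 hp
      exact hx i
    · exact Multiset.eq_of_mem_replicate hp ▸ h0
  have hcard : n + 2 ≤ (Finset.univ.val.map x + Multiset.replicate (N + 1) 0).card := by
    simp
    lia
  rw [contourCoeff, contourIntegral_congr hpole,
    hγ.integral_pow_mul_poleProd_eq_zero hencl (.inr hcard), mul_zero]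

theorem ne_zero_of_forall_norm_lt {z : ℂ} (hz : ∀ w ∈ trace γ, ‖w‖ < ‖z‖) : z ≠ 0 :=
  norm_pos_iff.1 <| (norm_nonneg _).trans_lt <|
    hz _ (Set.mem_image_of_mem γ (Set.left_mem_Icc.2 zero_le_one))

theorem IsContour.excludes_of_norm_lt (hγ : IsContour γ) {z : ℂ} (hz : ∀ w ∈ trace γ, ‖w‖ < ‖z‖) :
    Excludes γ z := by
  have hmem : z ∉ trace γ := fun h => (hz z h).false
  have hz0 := ne_zero_of_forall_norm_lt hz
  refine ⟨hmem, ?_⟩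
  have hcont : ContinuousOn (fun w => (w - z)⁻¹) (trace γ) :=
    (continuousOn_id.sub continuousOn_const).inv₀ fun w hw =>
      sub_ne_zero.2 (ne_of_mem_of_not_mem hw hmem)
  rw [windingNumber,
    hγ.integral_eq_zero (F := fun w => Complex.log (1 - w / z)) hcont fun w hw => ?_, mul_zero]
  have hslit : 1 - w / z ∈ Complex.slitPlane := by
    refine Complex.mem_slitPlane_of_norm_lt_one (z := -(w / z)) ?_
    rw [norm_neg, norm_div, div_lt_one (norm_pos_iff.2 hz0)]
    exact hz w hw
  have hderiv := (((hasDerivAt_id w).div_const z).const_sub 1).clog hslit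
  have hwz : w - z ≠ 0 := sub_ne_zero.2 (ne_of_mem_of_not_mem hw hmem)
  have heq : -(1 / z) / (1 - w / z) = (w - z)⁻¹ := by
    rw [show 1 - w / z = -(w - z) / z by field_simp; ring]
    field_simp
  exact heq ▸ hderiv

theorem hsymm_fin_one {K : Type*} [Field K] (x : Fin 1 → K) (r : ℤ) :
    hsymm x r = if 0 ≤ r then x 0 ^ r else 0 := by
  rw [hsymm]
  simp only [hsymm, Pi.single_apply, mul_ite, mul_one, mul_zero, Finset.sum_ite_eq', sub_zero]
  rcases le_or_gt 0 r with hr | hr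
  · simp [hr, ← zpow_natCast]
  · simp [hr.not_ge]

theorem IsContour.contourCoeff_inv_sub (hγ : IsContour γ) (h0 : Encircles γ 0) {z : ℂ}
    (hz : ∀ w ∈ trace γ, ‖w‖ < ‖z‖) (a : ℤ) :
    contourCoeff γ (fun w => (z - w)⁻¹) a = if 0 ≤ a then z ^ (-a - 1) else 0 := by
  have hz0 := ne_zero_of_forall_norm_lt hz
  have hgen (w : ℂ) : (z - w)⁻¹ * w ^ (-a - 1) =
      z⁻¹ * (hsymmGen (fun _ : Fin 1 => z⁻¹) w * w ^ (-a - 1)) := by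
    rw [← mul_assoc, hsymmGen, Fin.prod_univ_one, one_div, ← mul_inv, mul_sub, mul_one,
      mul_inv_cancel_left₀ hz0]
  have hcoeff := congrFun (hγ.contourCoeff_hsymmGen h0 (x := fun _ : Fin 1 => z⁻¹) fun _ _ => by
    simpa using hγ.excludes_of_norm_lt hz) a
  rw [contourCoeff] at hcoeff
  rw [contourCoeff, contourIntegral_congr fun w _ => hgen w, contourIntegral_const_mul,
    mul_left_comm, hcoeff, hsymm_fin_one, mul_ite, mul_zero, inv_zpow', ← zpow_neg_one z,
    ← zpow_add₀ hz0, neg_add_eq_sub]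

end HsymmGen

/-! ### The symbol and the double contour integral -/

section Symbol

variable {n k : ℕ} {x : Fin n → ℂ} {y : Fin k → ℂ} {γ : ℝ → ℂ}

/-- The symbol `∏ (1 - x_i z)⁻¹ ∏ (1 + y_j / z)⁻¹` of the kernel, for complex parameters. -/
def symbol (x : Fin n → ℂ) (y : Fin k → ℂ) (z : ℂ) : ℂ := hsymmGen x z * hsymmGen (-y) z⁻¹

theorem symbol_inv (x : Fin n → ℂ) (y : Fin k → ℂ) (z : ℂ) :
    (symbol x y z)⁻¹ = (∏ j, (1 + y j * z ^ (-1 : ℤ))) * ∏ i, (1 + (-x) i * z ^ (- -1 : ℤ)) := by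
  rw [symbol, mul_inv_rev, hsymmGen_inv, hsymmGen_inv, neg_neg, zpow_neg_one, neg_neg, zpow_one]

theorem mul_inv_ne_one_of_notMem {S : Set ℂ} (hy : ∀ j, y j ∉ S) {z : ℂ} (hz : z ∈ S)
    (j : Fin k) : y j * z⁻¹ ≠ 1 := fun h => hy j (eq_of_mul_inv_eq_one h ▸ hz)

theorem continuousOn_symbol {S : Set ℂ} (h0 : (0 : ℂ) ∉ S) (hx : ∀ i, x i ≠ 0 → (x i)⁻¹ ∉ S)
    (hy : ∀ j, (-y) j ∉ S) : ContinuousOn (symbol x y) S :=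
  (continuousOn_hsymmGen fun _ hz => mul_ne_one_of_inv_notMem hx hz).mul <|
    (continuousOn_hsymmGen (S := {z | ∀ j, (-y) j * z ≠ 1}) fun _ hz => hz).comp
      (continuousOn_inv₀.mono fun _ hz => ne_of_mem_of_not_mem hz h0)
      fun _ hz => mul_inv_ne_one_of_notMem hy hz

theorem IsContour.isSymbolCoeff_contourCoeff (hγ : IsContour γ) (h0 : Encircles γ 0)
    (hx : ∀ i, x i ≠ 0 → Excludes γ (x i)⁻¹) (hy : ∀ j, Encircles γ ((-y) j)) :
    IsSymbolCoeff x y (contourCoeff γ (symbol x y)) where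
  forward a ha := by
    rw [hγ.shiftAction_contourCoeff h0.1
      (continuousOn_symbol h0.1 (fun i hi => (hx i hi).1) fun j => (hy j).1), contourCoeff_congr
      (g := fun z => hsymmGen (-y) z⁻¹), hγ.contourCoeff_hsymmGen_inv h0 hy ha]
    intro z hz
    rw [neg_neg, zpow_one, ← hsymmGen_inv, symbol, inv_mul_cancel_left₀
      (hsymmGen_ne_zero fun i => mul_ne_one_of_inv_notMem (fun i hi => (hx i hi).1) hz i)]
  backward := by
    rw [hγ.shiftAction_contourCoeff h0.1
      (continuousOn_symbol h0.1 (fun i hi => (hx i hi).1) fun j => (hy j).1), contourCoeff_congr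
      (g := hsymmGen x), hγ.contourCoeff_hsymmGen h0 hx]
    intro z hz
    have hprod : ∏ j, (1 + y j * z ^ (-1 : ℤ)) = (hsymmGen (-y) z⁻¹)⁻¹ := by
      rw [hsymmGen_inv, neg_neg, zpow_neg_one]
    rw [hprod, symbol, mul_comm, mul_inv_cancel_right₀
      (hsymmGen_ne_zero fun j => mul_inv_ne_one_of_notMem (fun j => (hy j).1) hz j)]

theorem isUnit_one_add_mul (hx : ∀ i, x i ≠ 0 → Excludes γ (x i)⁻¹)
    (hy : ∀ j, Encircles γ ((-y) j)) (i : Fin n) (j : Fin k) : IsUnit (1 + x i * y j) := by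
  refine isUnit_iff_ne_zero.2 fun h => ?_
  have hxy : x i * (-y) j = 1 := by
    rw [Pi.neg_apply]
    linear_combination -h
  have hexcl := hx i (left_ne_zero_of_mul_eq_one hxy)
  rw [← eq_inv_of_mul_eq_one_right hxy] at hexcl
  exact one_ne_zero ((hy j).2.symm.trans hexcl.2)

theorem kernel_eq_sum_product (x : Fin n → ℂ) (y : Fin k → ℂ) (u : ℤ → ℂ) (M M' : ℤ) :
    kernel x y u M M' = ∑ q ∈ Finset.range (k + 1) ×ˢ Finset.range (n + 1),
      (if (q.2 : ℤ) ≤ q.1 - M' then esymm y q.1 * esymm (-x) q.2 else 0) *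
        u (M + (q.1 - M') - q.2) := by
  simp only [kernel, partner, Finset.mul_sum, Finset.sum_product, mul_ite, ite_mul, mul_zero,
    zero_mul, mul_assoc]

theorem IsContour.contourCoeff_symbol_inv_mul_inv_sub (hγ : IsContour γ) (h0 : Encircles γ 0)
    {z : ℂ} (hz : ∀ w ∈ trace γ, ‖w‖ < ‖z‖) (x : Fin n → ℂ) (y : Fin k → ℂ) (b : ℤ) :
    contourCoeff γ (fun w => (symbol x y w)⁻¹ * (z - w)⁻¹) b =
      ∑ q ∈ Finset.range (k + 1) ×ˢ Finset.range (n + 1),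
        (if (q.2 : ℤ) ≤ q.1 + b then esymm y q.1 * esymm (-x) q.2 else 0) *
          z ^ (-(q.1 + b - q.2) - 1) := by
  have hcont : ContinuousOn (fun w => (z - w)⁻¹) (trace γ) :=
    (continuousOn_const.sub continuousOn_id).inv₀ fun w hw =>
      sub_ne_zero.2 (ne_of_mem_of_not_mem hw (hγ.excludes_of_norm_lt hz).1).symm
  have hcont' : ContinuousOn (fun w => (∏ i, (1 + (-x) i * w ^ (- -1 : ℤ))) * (z - w)⁻¹)
      (trace γ) :=
    (continuousOn_finsetProd _ fun i _ => continuousOn_const.add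
      (continuousOn_const.mul (continuousOn_zpow_of_notMem h0.1 _))).mul hcont
  simp only [symbol_inv, mul_assoc]
  rw [← hγ.shiftAction_contourCoeff h0.1 hcont', ← hγ.shiftAction_contourCoeff h0.1 hcont,
    shiftAction_linearProd, Finset.sum_product]
  refine Finset.sum_congr rfl fun p _ => ?_
  rw [shiftAction_linearProd, Finset.mul_sum]
  refine Finset.sum_congr rfl fun i _ => ?_
  rw [hγ.contourCoeff_inv_sub h0 hz, show b + p * 1 + i * -1 = p + b - i by ring]
  simp only [sub_nonneg, mul_ite, ite_mul, mul_zero, zero_mul, mul_assoc]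

/-- Expanding `1 / symbol` in powers of `w` and `(z - w)⁻¹` in powers of `w / z` integrates out
`w`. -/
theorem contourCoeff_contourCoeff_eq_kernel {γz γw : ℝ → ℂ} (hγz : IsContour γz)
    (hγw : IsContour γw) (hz0 : (0 : ℂ) ∉ trace γz) (hw0 : Encircles γw 0)
    (hlt : ∀ z ∈ trace γz, ∀ w ∈ trace γw, ‖w‖ < ‖z‖)
    (hcont : ContinuousOn (symbol x y) (trace γz)) (M M' : ℤ) :
    contourCoeff γz (fun z => contourCoeff γw (fun w => (symbol x y w)⁻¹ * (z - w)⁻¹) (-M') *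
      symbol x y z) (M - 1) = kernel x y (contourCoeff γz (symbol x y)) M M' := by
  rw [contourCoeff_congr fun z hz => by
      rw [hγw.contourCoeff_symbol_inv_mul_inv_sub hw0 (hlt z hz)],
    hγz.contourCoeff_sum_zpow_mul hz0 hcont, kernel_eq_sum_product]
  refine Finset.sum_congr rfl fun q _ => ?_
  rw [← sub_eq_add_neg]
  ring_nf

end Symbol

section Admissible

variable {n k : ℕ} {x : Fin n → ℝ} {y : Fin k → ℝ} {γz γw : ℝ → ℂ}

theorem symbolK_eq_symbol (x : Fin n → ℝ) (y : Fin k → ℝ) :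
    symbolK x y = symbol (fun i => (x i : ℂ)) (fun j => (y j : ℂ)) := by
  funext z
  simp [symbolK, symbol, hsymmGen, div_eq_mul_inv]

theorem kernelIntegrand_eq (x : Fin n → ℝ) (y : Fin k → ℝ) {M M' : ℤ} {m m' : ℝ}
    (hm : m = M - 1 / 2) (hm' : m' = M' - 1 / 2) {z w : ℂ} (hz : z ≠ 0) (hw : w ≠ 0) :
    kernelIntegrand x y m m' z w =
      symbolK x y z * z ^ (1 - M) * ((symbolK x y w)⁻¹ * (z - w)⁻¹ * w ^ M') := by
  have hzpow : z ^ (-(m : ℂ)) * z ^ (1 / 2 : ℂ) = z ^ (1 - M) := by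
    rw [← Complex.cpow_add _ _ hz, ← Complex.cpow_intCast, hm]
    push_cast
    ring_nf
  have hwpow : w ^ (m' : ℂ) * w ^ (1 / 2 : ℂ) = w ^ M' := by
    rw [← Complex.cpow_add _ _ hw, ← Complex.cpow_intCast, hm']
    push_cast
    ring_nf
  rw [kernelIntegrand, ← hzpow, ← hwpow]
  ring

theorem kernelIntegral_eq_contourCoeff (hz0 : (0 : ℂ) ∉ trace γz) (hw0 : (0 : ℂ) ∉ trace γw)
    {M M' : ℤ} {m m' : ℝ} (hm : m = M - 1 / 2) (hm' : m' = M' - 1 / 2) :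
    kernelIntegral x y γz γw m m' = contourCoeff γz (fun z =>
      contourCoeff γw (fun w => (symbolK x y w)⁻¹ * (z - w)⁻¹) (-M') * symbolK x y z) (M - 1) := by
  rw [kernelIntegral, contourCoeff, ← contourIntegral_const_mul]
  refine contourIntegral_congr fun z hz => ?_
  have hz : z ≠ 0 := ne_of_mem_of_not_mem hz hz0
  have hinner (w : ℂ) (hw : w ∈ trace γw) :
      1 / (2 * Real.pi * Complex.I * w) * kernelIntegrand x y m m' z w =
        symbolK x y z * z ^ (1 - M) * (2 * Real.pi * Complex.I)⁻¹ *
          ((symbolK x y w)⁻¹ * (z - w)⁻¹ * w ^ (- -M' - 1)) := by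
    have hw : w ≠ 0 := ne_of_mem_of_not_mem hw hw0
    rw [kernelIntegrand_eq x y hm hm' hz hw, neg_neg, zpow_sub_one₀ hw, one_div, mul_inv]
    ring
  rw [contourIntegral_congr hinner, contourIntegral_const_mul, contourCoeff,
    show -(M - 1) - 1 = 1 - M - 1 by ring, zpow_sub_one₀ hz, one_div, mul_inv]
  ring

theorem AdmissibleContours.excludes_ofReal_inv (h : AdmissibleContours x y γz γw) (i : Fin n)
    (hi : (x i : ℂ) ≠ 0) : Excludes γz (x i : ℂ)⁻¹ :=
  h.excludes_x i (Complex.ofReal_ne_zero.1 hi)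

theorem AdmissibleContours.isSymbolCoeff (h : AdmissibleContours x y γz γw) :
    IsSymbolCoeff (fun i => (x i : ℂ)) (fun j => (y j : ℂ)) (contourCoeff γz (symbolK x y)) := by
  rw [symbolK_eq_symbol]
  exact h.contour_z.isSymbolCoeff_contourCoeff h.zero_z h.excludes_ofReal_inv
    h.contains_y

theorem AdmissibleContours.kernelIntegral_eq (h : AdmissibleContours x y γz γw) {M M' : ℤ}
    {m m' : ℝ} (hm : m = M - 1 / 2) (hm' : m' = M' - 1 / 2) :
    kernelIntegral x y γz γw m m' = kernel (fun i => (x i : ℂ)) (fun j => (y j : ℂ))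
      (contourCoeff γz (symbolK x y)) M M' := by
  rw [kernelIntegral_eq_contourCoeff h.zero_z.1 h.zero_w.1 hm hm', symbolK_eq_symbol]
  exact contourCoeff_contourCoeff_eq_kernel h.contour_z h.contour_w h.zero_z.1 h.zero_w h.norm_lt
    (continuousOn_symbol h.zero_z.1 (fun i hi => (h.excludes_ofReal_inv i hi).1)
      fun j => (h.contains_y j).1) M M'

theorem AdmissibleContours.contourCoeff_eq (h : AdmissibleContours x y γz γw) {γz' γw' : ℝ → ℂ}
    (h' : AdmissibleContours x y γz' γw') :
    contourCoeff γz (symbolK x y) = contourCoeff γz' (symbolK x y) :=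
  h.isSymbolCoeff.unique h'.isSymbolCoeff <| isUnit_one_add_mul
    h.excludes_ofReal_inv h.contains_y

end Admissible

/-! ### Circles as contours -/

section Circle

variable {a p : ℂ} {R : ℝ}

/-- The circle of centre `a` and radius `R`, parametrized by `[0, 1]` as `IsContour` requires. -/
def circleContour (a : ℂ) (R : ℝ) (t : ℝ) : ℂ := circleMap a R (2 * Real.pi * t)

theorem isContour_circleContour (a : ℂ) (R : ℝ) : IsContour (circleContour a R) := by
  refine ⟨?_, 1, fun i => i, Nat.mono_cast, by simp, by simp, fun i _ => ?_⟩
  · simp [circleContour, circleMap, Complex.exp_two_pi_mul_I]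
  · exact ((contDiff_circleMap a R).comp (contDiff_const.mul contDiff_id)).contDiffOn

theorem contourIntegral_circleContour (a : ℂ) (R : ℝ) (f : ℂ → ℂ) :
    contourIntegral (circleContour a R) f = ∮ z in C(a, R), f z := by
  have hderiv (t : ℝ) : deriv (circleContour a R) t =
      (2 * Real.pi) • deriv (circleMap a R) (2 * Real.pi * t) := by
    have hlin : HasDerivAt (fun t : ℝ => 2 * Real.pi * t) (2 * Real.pi) t := by
      simpa using (hasDerivAt_id t).const_mul (2 * Real.pi)
    rw [deriv_circleMap]
    exact ((hasDerivAt_circleMap a R (2 * Real.pi * t)).scomp t hlin).deriv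
  have hsubst := intervalIntegral.smul_integral_comp_mul_left (a := 0) (b := 1)
    (fun θ => deriv (circleMap a R) θ • f (circleMap a R θ)) (2 * Real.pi)
  rw [mul_zero, mul_one] at hsubst
  rw [contourIntegral, circleIntegral, ← hsubst, ← intervalIntegral.integral_smul]
  refine intervalIntegral.integral_congr fun t _ => ?_
  simp only [hderiv, circleContour, smul_eq_mul, Complex.real_smul]
  ring

theorem norm_sub_of_mem_trace_circleContour (hR : 0 ≤ R) {z : ℂ}
    (hz : z ∈ trace (circleContour a R)) : ‖z - a‖ = R := by
  obtain ⟨t, _, rfl⟩ := hz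
  rw [circleContour, circleMap_sub_center, norm_circleMap_zero, abs_of_nonneg hR]

theorem encircles_circleContour (hp : ‖p - a‖ < R) : Encircles (circleContour a R) p := by
  have hR : 0 ≤ R := (norm_nonneg _).trans hp.le
  refine ⟨fun h => hp.ne (norm_sub_of_mem_trace_circleContour hR h), ?_⟩
  rw [windingNumber, contourIntegral_circleContour, circleIntegral.integral_sub_inv_of_mem_ball
    (mem_ball_iff_norm.2 hp), inv_mul_cancel₀ Complex.two_pi_I_ne_zero]

theorem excludes_circleContour (hR : 0 ≤ R) (hp : R < ‖p - a‖) :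
    Excludes (circleContour a R) p := by
  refine ⟨fun h => hp.ne' (norm_sub_of_mem_trace_circleContour hR h), ?_⟩
  rw [windingNumber, contourIntegral_circleContour, DiffContOnCl.circleIntegral_eq_zero hR,
    mul_zero]
  refine DifferentiableOn.diffContOnCl fun z hz => ?_
  have hz : ‖z - a‖ ≤ R := mem_closedBall_iff_norm.1 (Metric.closure_ball_subset_closedBall hz)
  have hne : z - p ≠ 0 := sub_ne_zero.2 fun h => hp.not_ge (h ▸ hz)
  exact ((differentiableAt_id.sub_const p).inv hne).differentiableWithinAt

end Circle

/-- With `c = ∑ y_j` and `ε < x_i⁻¹` for all `i`, the circle about `-c` through `ε` meets the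
real axis in `ε` and `-2c - ε`; the circle about `0` of radius `ε / 2` lies inside it. -/
theorem exists_admissibleContours {n k : ℕ} {x : Fin n → ℝ} {y : Fin k → ℝ}
    (hx : ∀ i, 0 ≤ x i) (hy : ∀ j, 0 ≤ y j) :
    ∃ γz γw : ℝ → ℂ, AdmissibleContours x y γz γw := by
  set c : ℝ := ∑ j, y j
  set ε : ℝ := (1 + ∑ i, x i)⁻¹
  have hc : 0 ≤ c := Finset.sum_nonneg fun j _ => hy j
  have hε : 0 < ε :=
    inv_pos.2 (add_pos_of_pos_of_nonneg one_pos (Finset.sum_nonneg fun i _ => hx i))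
  have hle (j : Fin k) : y j ≤ c := Finset.single_le_sum (fun j _ => hy j) (Finset.mem_univ j)
  have hlt (i : Fin n) (hi : x i ≠ 0) : ε < (x i)⁻¹ := by
    have hsum := Finset.single_le_sum (fun i _ => hx i) (Finset.mem_univ i)
    exact inv_strictAnti₀ ((hx i).lt_of_ne' hi) (by linarith)
  refine ⟨circleContour (-c) (c + ε), circleContour 0 (ε / 2), isContour_circleContour _ _,
    isContour_circleContour _ _, fun z hz w hw => ?_, encircles_circleContour ?_,
    encircles_circleContour (by simpa using hε), fun j => encircles_circleContour ?_,
    fun i hi => excludes_circleContour (by positivity) ?_⟩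
  · have hznorm := norm_sub_of_mem_trace_circleContour (by positivity) hz
    have hwnorm := norm_sub_of_mem_trace_circleContour (by positivity) hw
    have hcnorm : ‖(c : ℂ)‖ = c := by rw [Complex.norm_real, Real.norm_of_nonneg hc]
    have htri := norm_add_le z (c : ℂ)
    rw [sub_neg_eq_add] at hznorm
    rw [sub_zero] at hwnorm
    linarith
  · rw [zero_sub, neg_neg, Complex.norm_real, Real.norm_of_nonneg hc]
    linarith
  · rw [neg_sub_neg, ← Complex.ofReal_sub, Complex.norm_real,
      Real.norm_of_nonneg (sub_nonneg.2 (hle j))]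
    linarith [hy j]
  · rw [sub_neg_eq_add, ← Complex.ofReal_inv, ← Complex.ofReal_add, Complex.norm_real,
      Real.norm_of_nonneg (add_nonneg (inv_nonneg.2 (hx i)) hc)]
    linarith [hlt i hi]

end DualCauchy

end

theorem theorem1p1_general {n k : ℕ} {x : Fin n → ℝ} {y : Fin k → ℝ} {γz γw : ℝ → ℂ}
    (h : DualCauchy.AdmissibleContours x y γz γw) :
    (∀ γz' γw' : ℝ → ℂ, DualCauchy.AdmissibleContours x y γz' γw' →
      ∀ m ∈ DualCauchy.halfIntegers, ∀ m' ∈ DualCauchy.halfIntegers,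
        DualCauchy.kernelIntegral x y γz γw m m' =
          DualCauchy.kernelIntegral x y γz' γw' m m') ∧
    (∀ lam ∈ DualCauchy.boxDiagrams n k,
      (DualCauchy.dualCauchyMeasure x y lam : ℂ) =
        Matrix.det (Matrix.of fun i j : Fin n => DualCauchy.kernelIntegral x y γz γw
          (DualCauchy.mayaCoord lam i) (DualCauchy.mayaCoord lam j))) ∧
    (∀ (r : ℕ) (s : Fin r → ℝ), Function.Injective s →
      (∀ i, s i ∈ DualCauchy.halfIntegers) →
      (DualCauchy.correlation x y s : ℂ) =
        Matrix.det (Matrix.of fun i j : Fin r =>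
          DualCauchy.kernelIntegral x y γz γw (s i) (s j))) := by
  refine ⟨fun γz' γw' h' m hm m' hm' => ?_, fun lam hlam => ?_, fun r s hs hhalf => ?_⟩
  · obtain ⟨M, hM⟩ := DualCauchy.exists_eq_sub_half hm
    obtain ⟨M', hM'⟩ := DualCauchy.exists_eq_sub_half hm'
    rw [h.kernelIntegral_eq hM hM', h'.kernelIntegral_eq hM hM', h.contourCoeff_eq h']
  · rw [h.isSymbolCoeff.dualCauchyMeasure_eq_det_kernel hlam]
    simp only [h.kernelIntegral_eq (DualCauchy.mayaCoord_eq lam _) (DualCauchy.mayaCoord_eq lam _)]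
  · choose S hS using fun i => DualCauchy.exists_eq_sub_half (hhalf i)
    obtain rfl : s = fun i => (S i : ℝ) - 1 / 2 := funext hS
    rw [h.isSymbolCoeff.correlation_eq_det_kernel fun i j hij => hs (by simp only [hij])]
    simp only [h.kernelIntegral_eq rfl rfl]

theorem theorem1p1 (n k : ℕ) (x : Fin n → ℝ) (y : Fin k → ℝ)
    (hx : ∀ i, 0 ≤ x i) (hy : ∀ j, 0 ≤ y j) :
    (∃ γz γw : ℝ → ℂ, DualCauchy.AdmissibleContours x y γz γw) ∧
    ∃ 𝒦 : ℝ → ℝ → ℂ,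
      (∀ γz γw : ℝ → ℂ, DualCauchy.AdmissibleContours x y γz γw →
        ∀ m ∈ DualCauchy.halfIntegers, ∀ m' ∈ DualCauchy.halfIntegers,
          𝒦 m m' = DualCauchy.kernelIntegral x y γz γw m m') ∧
      (∀ lam ∈ DualCauchy.boxDiagrams n k,
        (DualCauchy.dualCauchyMeasure x y lam : ℂ) =
          Matrix.det (Matrix.of fun i j : Fin n =>
            𝒦 (DualCauchy.mayaCoord lam i) (DualCauchy.mayaCoord lam j))) ∧
      (∀ (r : ℕ) (s : Fin r → ℝ), Function.Injective s →
        (∀ i, s i ∈ DualCauchy.halfIntegers) →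
        (DualCauchy.correlation x y s : ℂ) =
          Matrix.det (Matrix.of fun i j : Fin r => 𝒦 (s i) (s j))) := by
  obtain ⟨γz, γw, h⟩ := DualCauchy.exists_admissibleContours hx hy
  exact ⟨⟨γz, γw, h⟩, DualCauchy.kernelIntegral x y γz γw, theorem1p1_general h⟩
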